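/- Let $n\ge 1$ and let $\Omega\subset\mathbb R^n$ be a bounded open set with $C^1$ boundary. Let $\sigma$ be the $(n-1)$-dimensional surface measure on $\partial\Omega$, and let $\{\Gamma_0,\Gamma_1\}$ be a partition of the boundary, $\partial\Omega=\Gamma_0\cup\Gamma_1$, with $\overline{\Gamma_0}\cap\overline{\Gamma_1}=\emptyset$ and $\sigma(\Gamma_0)>0$; assume moreover that $\sigma(\Gamma_0\cap\partial C)>0$ for every connected component $C$ of $\Omega$ (this is automatic if $\Omega$ is connected). Let $H^1_{\Gamma_0}(\Omega)$ be the space of all $w\in H^1(\Omega)$ whose trace on $\partial\Omega$ vanishes $\sigma$-a.e. on $\Gamma_0$. Write $\|\cdot\|_q$ for the norm of $L^q(\Omega)$ and $\|w\|_{2,\Gamma_1}$ for the $L^2(\Gamma_1,\sigma)$-norm of the trace of $w$, and put $$S_1=\sup_{0\ne w\in H^1_{\Gamma_0}(\Omega)}\frac{\|w\|_{2,\Gamma_1}^2}{\|\nabla w\|_2^2},\qquad S_2=\sup_{0\ne w\in H^1_{\Gamma_0}(\Omega)}\frac{\|w\|_{2}^2}{\|\nabla w\|_2^2}.$$ Let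 $2<p\le 1+\frac{2^*}{2}$, where $2^*=\frac{2n}{n-2}$ if $n\ge3$ and $2^*=\infty$ if $n=1,2$, and for $w\in H^1_{\Gamma_0}(\Omega)$ define $$J(w)=\frac12\|\nabla w\|_2^2-\frac1p\|w\|_p^p,$$ $$\mathcal B_2=\Big\{w\in H^1_{\Gamma_0}(\Omega)\ :\ J(w)<\frac{p-2}{2p(S_1+S_2)}\big(\|w\|_2^2+\|w\|_{2,\Gamma_1}^2\big)\Big\}.$$ Then for every $a\in\mathbb R$ the energy level set $J^a=\{w\in H^1_{\Gamma_0}(\Omega): J(w)=a\}$ satisfies $J^a\cap\mathcal B_2\neq\emptyset$. -/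

import Mathlib

open MeasureTheory Filter Topology Set
open scoped ENNReal ContDiff

noncomputable section

namespace BlowUp

/-- `Ω` has a `C¹` boundary: near each boundary point, in suitable orthonormal coordinates whose
last axis is directed by the unit vector `e`, the set `Ω` is the region strictly above the graph of
a `C¹` function `γ` of the remaining coordinates (the component `y - ⟪e, y⟫ e` orthogonal to `e`). -/
def HasC1Boundary {n : ℕ} (Ω : Set (EuclideanSpace ℝ (Fin n))) : Prop :=
  ∀ x ∈ frontier Ω, ∃ (e : EuclideanSpace ℝ (Fin n)) (γ : EuclideanSpace ℝ (Fin n) → ℝ) (r : ℝ),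
    ‖e‖ = 1 ∧ ContDiff ℝ 1 γ ∧ 0 < r ∧
      ∀ y ∈ Metric.ball x r, y ∈ Ω ↔ γ (y - inner ℝ e y • e) < inner ℝ e y

/-- The surface measure `σ` on `∂Ω`: the `(n-1)`-dimensional Hausdorff measure, normalized so that
it agrees with Lebesgue measure on `(n-1)`-dimensional subspaces, restricted to `∂Ω`
(the counting measure on `∂Ω` if `n = 1`). -/
def surfaceMeasure {n : ℕ} (Ω : Set (EuclideanSpace ℝ (Fin n))) :
    Measure (EuclideanSpace ℝ (Fin n)) :=
  (Measure.euclideanHausdorffMeasure (n - 1)).restrict (frontier Ω)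

/-- The space `L²(Ω)`. -/
abbrev L2 {n : ℕ} (Ω : Set (EuclideanSpace ℝ (Fin n))) : Type :=
  Lp ℝ 2 (volume.restrict Ω)

/-- The space `L²(Ω; ℝⁿ)`. -/
abbrev L2Vec {n : ℕ} (Ω : Set (EuclideanSpace ℝ (Fin n))) : Type :=
  Lp (EuclideanSpace ℝ (Fin n)) 2 (volume.restrict Ω)

/-- The space `L²(∂Ω)`. -/
abbrev L2Boundary {n : ℕ} (Ω : Set (EuclideanSpace ℝ (Fin n))) : Type :=
  Lp ℝ 2 (surfaceMeasure Ω)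

/-- `G ∈ L²(Ω; ℝⁿ)` is the weak (distributional) gradient of `w ∈ L²(Ω)` in `Ω`. -/
def IsWeakGradient {n : ℕ} (Ω : Set (EuclideanSpace ℝ (Fin n))) (w : L2 Ω) (G : L2Vec Ω) : Prop :=
  ∀ φ : EuclideanSpace ℝ (Fin n) → ℝ, ContDiff ℝ ∞ φ → HasCompactSupport φ → tsupport φ ⊆ Ω →
    ∀ i : Fin n,
      ∫ x in Ω, w x * fderiv ℝ φ x (EuclideanSpace.single i 1) = -∫ x in Ω, G x i * φ x

/-- The Sobolev space `H¹(Ω) = W^{1,2}(Ω)`, as a subset of `L²(Ω)`. -/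
def H1 {n : ℕ} (Ω : Set (EuclideanSpace ℝ (Fin n))) : Set (L2 Ω) :=
  {w | ∃ G : L2Vec Ω, IsWeakGradient Ω w G}

open Classical in
/-- The weak gradient `∇w` of `w ∈ H¹(Ω)` (`0` outside `H¹(Ω)`). -/
def weakGradient {n : ℕ} (Ω : Set (EuclideanSpace ℝ (Fin n))) (w : L2 Ω) : L2Vec Ω :=
  if h : ∃ G : L2Vec Ω, IsWeakGradient Ω w G then h.choose else 0

/-- `g ∈ L²(∂Ω)` is the trace of `w` on `∂Ω`: there are smooth functions `φ k` on `ℝⁿ` that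
converge to `w` in `H¹(Ω)` and whose restrictions to `∂Ω` converge to `g` in `L²(∂Ω)`.
On a bounded open set with `C¹` boundary this is the graph of the unique continuous extension
to `H¹(Ω)` of the restriction map `φ ↦ φ|_∂Ω` on `C^∞(closure Ω)`. -/
def IsTrace {n : ℕ} (Ω : Set (EuclideanSpace ℝ (Fin n))) (w : L2 Ω) (g : L2Boundary Ω) : Prop :=
  ∃ φ : ℕ → EuclideanSpace ℝ (Fin n) → ℝ, (∀ k, ContDiff ℝ ∞ (φ k)) ∧
    Tendsto (fun k => eLpNorm (fun x => φ k x - w x) 2 (volume.restrict Ω)) atTop (𝓝 0) ∧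
    Tendsto (fun k => eLpNorm (fun x => gradient (φ k) x - weakGradient Ω w x) 2
      (volume.restrict Ω)) atTop (𝓝 0) ∧
    Tendsto (fun k => eLpNorm (fun x => φ k x - g x) 2 (surfaceMeasure Ω)) atTop (𝓝 0)

open Classical in
/-- The trace on `∂Ω` of `w ∈ H¹(Ω)`. -/
def trace {n : ℕ} (Ω : Set (EuclideanSpace ℝ (Fin n))) (w : L2 Ω) : L2Boundary Ω :=
  if h : ∃ g : L2Boundary Ω, IsTrace Ω w g then h.choose else 0

/-- The space `H¹_{Γ₀}(Ω)` of all `w ∈ H¹(Ω)` whose trace vanishes `σ`-a.e. on `Γ₀`. -/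
def H1Gamma {n : ℕ} (Ω Γ₀ : Set (EuclideanSpace ℝ (Fin n))) : Set (L2 Ω) :=
  {w | w ∈ H1 Ω ∧ ∃ g : L2Boundary Ω, IsTrace Ω w g ∧ ∀ᵐ x ∂(surfaceMeasure Ω), x ∈ Γ₀ → g x = 0}

/-- `‖w‖²_{2,Γ₁}`, the squared `L²(Γ₁)`-norm of the trace of `w`. -/
def boundaryNormSq {n : ℕ} (Ω Γ₁ : Set (EuclideanSpace ℝ (Fin n))) (w : L2 Ω) : ℝ :=
  ∫ x in Γ₁, (trace Ω w x) ^ 2 ∂(surfaceMeasure Ω)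

/-- `S₁ = sup {‖w‖²_{2,Γ₁} / ‖∇w‖₂² : w ∈ H¹_{Γ₀}(Ω), w ≠ 0}`, taken in `[0, ∞]`. -/
def S1 {n : ℕ} (Ω Γ₀ Γ₁ : Set (EuclideanSpace ℝ (Fin n))) : ℝ≥0∞ :=
  ⨆ w ∈ {w : L2 Ω | w ∈ H1Gamma Ω Γ₀ ∧ w ≠ 0},
    ENNReal.ofReal (boundaryNormSq Ω Γ₁ w) / ENNReal.ofReal (‖weakGradient Ω w‖ ^ 2)

/-- `S₂ = sup {‖w‖₂² / ‖∇w‖₂² : w ∈ H¹_{Γ₀}(Ω), w ≠ 0}`, taken in `[0, ∞]`. -/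
def S2 {n : ℕ} (Ω Γ₀ : Set (EuclideanSpace ℝ (Fin n))) : ℝ≥0∞ :=
  ⨆ w ∈ {w : L2 Ω | w ∈ H1Gamma Ω Γ₀ ∧ w ≠ 0},
    ENNReal.ofReal (‖w‖ ^ 2) / ENNReal.ofReal (‖weakGradient Ω w‖ ^ 2)

/-- The energy `J(w) = ½ ‖∇w‖₂² - (1/p) ‖w‖_p^p`. -/
def J {n : ℕ} (Ω : Set (EuclideanSpace ℝ (Fin n))) (p : ℝ) (w : L2 Ω) : ℝ :=
  1 / 2 * ‖weakGradient Ω w‖ ^ 2 - 1 / p * ∫ x in Ω, |w x| ^ p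

/-- The energy level set `J^a = {w ∈ H¹_{Γ₀}(Ω) : J(w) = a}`. -/
def levelSet {n : ℕ} (Ω Γ₀ : Set (EuclideanSpace ℝ (Fin n))) (p a : ℝ) : Set (L2 Ω) :=
  {w | w ∈ H1Gamma Ω Γ₀ ∧ J Ω p w = a}

/-- The set `𝓑₂` of all `w ∈ H¹_{Γ₀}(Ω)` with
`J(w) < (p - 2) / (2 p (S₁ + S₂)) (‖w‖₂² + ‖w‖²_{2,Γ₁})`. If `S₁ + S₂ = ∞`, which the
boundedness of the trace map and the Poincaré inequality exclude, the quotient is `0`. -/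
def B2 {n : ℕ} (Ω Γ₀ Γ₁ : Set (EuclideanSpace ℝ (Fin n))) (p : ℝ) : Set (L2 Ω) :=
  {w | w ∈ H1Gamma Ω Γ₀ ∧
    J Ω p w < (p - 2) / (2 * p * (S1 Ω Γ₀ Γ₁ + S2 Ω Γ₀).toReal) *
      (‖w‖ ^ 2 + boundaryNormSq Ω Γ₁ w)}

end BlowUp

end

/-! Write `c` for the coefficient `(p - 2) / (2 p (S₁ + S₂))` in the definition of `𝓑₂`. Once `c >
0`, any `w` with `J(w) = a` and `c ‖w‖₂² > |a|` lies in `J^a ∩ 𝓑₂`, because the boundary term is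
nonnegative. Such a `w` is a multiple `tψ`, `t ≥ 1`, of a test function `ψ` with large `L²` norm and
large energy (`exists_isTestFunction_large`). As `p > 2`, `J(tψ) → -∞`, so by continuity `J(tψ)`
takes the value `a` (`exists_J_const_smul_eq`), while `‖tψ‖₂ ≥ ‖ψ‖₂`. To build `ψ`, add to a large
bump `χ` a rapidly oscillating `η` with `|η| ≤ |χ|`: the `L^p` term stays bounded while the gradient
is as large as desired.

The analytic work is `c > 0`, that is `0 < S₁ + S₂ < ∞`. Finiteness (`S1_add_S2_ne_top`) combines a
trace inequality with a Poincaré inequality with boundary term on `Γ₀`. Both are proved for `C¹`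
functions by integrating along segments and pass to `H¹_{Γ₀}(Ω)` by density. The Poincaré inequality
is first local: it holds near `Γ₀` by a graph chart, spreads through each component of `Ω` by
translating small balls, reaches the rest of `∂Ω` by pushing inwards, and is summed over the compact
set `closure Ω`. -/

namespace BlowUp

/-! ### One-dimensional estimates and their versions along segments. -/

theorem ennreal_add_sq_le (a b : ℝ≥0∞) : (a + b) ^ 2 ≤ 2 * (a ^ 2 + b ^ 2) := by
  have h := ENNReal.rpow_add_le_mul_rpow_add_rpow a b (p := 2) (by norm_num)
  norm_num at h
  simpa using h

theorem sq_lintegral_le {α : Type*} [MeasurableSpace α] (μ : Measure α) {f : α → ℝ≥0∞}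
    (hf : AEMeasurable f μ) : (∫⁻ x, f x ∂μ) ^ 2 ≤ μ univ * ∫⁻ x, f x ^ 2 ∂μ := by
  have h := ENNReal.lintegral_mul_le_Lp_mul_Lq μ (p := 2) (q := 2)
    (Real.HolderConjugate.two_two) (f := fun _ => 1) (g := f) aemeasurable_const hf
  simp only [Pi.mul_apply, one_mul, ENNReal.one_rpow, lintegral_const] at h
  calc (∫⁻ x, f x ∂μ) ^ 2
      ≤ (μ univ ^ (1 / 2 : ℝ) * (∫⁻ x, f x ^ (2 : ℝ) ∂μ) ^ (1 / 2 : ℝ)) ^ 2 := by gcongr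
    _ = _ := by
      rw [mul_pow, ← ENNReal.rpow_natCast, ← ENNReal.rpow_natCast, ← ENNReal.rpow_mul,
        ← ENNReal.rpow_mul]
      norm_num

/-- Fundamental theorem of calculus plus Cauchy–Schwarz. Both endpoints are free: `s = 0` bounds a
segment by its base point, and averaging over `s` bounds the base point by the segment. -/
theorem sq_enorm_le_of_contDiff {g : ℝ → ℝ} (hg : ContDiff ℝ 1 g) {ρ s t : ℝ}
    (hs : s ∈ Icc 0 ρ) (ht : t ∈ Icc 0 ρ) :
    ‖g t‖ₑ ^ 2 ≤
      2 * (‖g s‖ₑ ^ 2 + ENNReal.ofReal ρ * ∫⁻ τ in Icc 0 ρ, ‖deriv g τ‖ₑ ^ 2) := by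
  have key : ‖g t - g s‖ₑ ≤ ∫⁻ τ in Icc 0 ρ, ‖deriv g τ‖ₑ := by
    rcases le_total s t with h | h
    · refine (enorm_sub_le_lintegral_deriv_of_contDiffOn_Icc hg.contDiffOn h).trans ?_
      exact lintegral_mono_set (Icc_subset_Icc hs.1 ht.2)
    · rw [← enorm_neg, neg_sub]
      refine (enorm_sub_le_lintegral_deriv_of_contDiffOn_Icc hg.contDiffOn h).trans ?_
      exact lintegral_mono_set (Icc_subset_Icc ht.1 hs.2)
  have hcs := sq_lintegral_le (volume.restrict (Icc 0 ρ)) (f := fun τ => ‖deriv g τ‖ₑ)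
    (hg.continuous_deriv le_rfl).enorm.aemeasurable
  simp only [Measure.restrict_apply_univ, Real.volume_Icc, sub_zero] at hcs
  calc ‖g t‖ₑ ^ 2 = ‖g s + (g t - g s)‖ₑ ^ 2 := by congr 2; ring
    _ ≤ (‖g s‖ₑ + ‖g t - g s‖ₑ) ^ 2 := by gcongr; exact enorm_add_le _ _
    _ ≤ 2 * (‖g s‖ₑ ^ 2 + ‖g t - g s‖ₑ ^ 2) := ennreal_add_sq_le _ _
    _ ≤ _ := by
      gcongr
      exact (pow_le_pow_left' key 2).trans hcs

section Euclidean

variable {E : Type*} [NormedAddCommGroup E] [InnerProductSpace ℝ E]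

theorem enorm_deriv_line_le {φ : E → ℝ} (hφ : ContDiff ℝ 1 φ) (y v : E) (t : ℝ) :
    ‖deriv (fun τ : ℝ => φ (y + τ • v)) t‖ₑ ≤ ‖fderiv ℝ φ (y + t • v)‖ₑ * ‖v‖ₑ := by
  have h1 : HasDerivAt (fun τ : ℝ => y + τ • v) v t := by
    simpa using ((hasDerivAt_id t).smul_const v).const_add y
  have h2 := ((hφ.differentiable one_ne_zero) (y + t • v)).hasFDerivAt.comp_hasDerivAt t h1
  have h3 : deriv (fun τ : ℝ => φ (y + τ • v)) t = fderiv ℝ φ (y + t • v) v := h2.deriv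
  rw [h3]
  exact (fderiv ℝ φ (y + t • v)).le_opENorm v

theorem contDiff_line {φ : E → ℝ} (hφ : ContDiff ℝ 1 φ) (y v : E) :
    ContDiff ℝ 1 (fun τ : ℝ => φ (y + τ • v)) :=
  hφ.comp (by fun_prop)

theorem sq_enorm_line_le {φ : E → ℝ} (hφ : ContDiff ℝ 1 φ) (y v : E) {ρ s t : ℝ}
    (hs : s ∈ Icc 0 ρ) (ht : t ∈ Icc 0 ρ) :
    ‖φ (y + t • v)‖ₑ ^ 2 ≤ 2 * (‖φ (y + s • v)‖ₑ ^ 2 +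
      ENNReal.ofReal ρ * (‖v‖ₑ ^ 2 * ∫⁻ τ in Icc 0 ρ, ‖fderiv ℝ φ (y + τ • v)‖ₑ ^ 2)) := by
  refine (sq_enorm_le_of_contDiff (contDiff_line hφ y v) hs ht).trans ?_
  gcongr
  rw [← lintegral_const_mul' _ _ (by simp)]
  refine lintegral_mono fun τ => ?_
  rw [← mul_pow, mul_comm]
  gcongr
  exact enorm_deriv_line_le hφ y v τ

variable [MeasurableSpace E] [BorelSpace E]

theorem measurable_sq_enorm_fderiv {φ : E → ℝ} (hφ : ContDiff ℝ 1 φ) :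
    Measurable fun x => ‖fderiv ℝ φ x‖ₑ ^ 2 :=
  ((hφ.continuous_fderiv one_ne_zero).enorm.measurable).pow_const 2

variable [FiniteDimensional ℝ E]

/-- Control of the `L²` norm on a translate `A + v` when the swept region lies in `Ω`. -/
theorem lintegral_sq_translate_le {φ : E → ℝ} (hφ : ContDiff ℝ 1 φ) {A Ω : Set E}
    (hA : MeasurableSet A) (hΩ : MeasurableSet Ω) (v : E)
    (h : ∀ y ∈ A, ∀ t ∈ Icc (0 : ℝ) 1, y + t • v ∈ Ω) :
    ∫⁻ y in A, ‖φ (y + v)‖ₑ ^ 2 ≤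
      2 * ((∫⁻ y in A, ‖φ y‖ₑ ^ 2) + ‖v‖ₑ ^ 2 * ∫⁻ y in Ω, ‖fderiv ℝ φ y‖ₑ ^ 2) := by
  have hm := measurable_sq_enorm_fderiv hφ
  have hmφ : Measurable fun y => ‖φ y‖ₑ ^ 2 := hφ.continuous.enorm.measurable.pow_const 2
  have hm2 : Measurable (Function.uncurry fun (y : E) (τ : ℝ) =>
      ‖fderiv ℝ φ (y + τ • v)‖ₑ ^ 2) :=
    hm.comp (g := fun x => ‖fderiv ℝ φ x‖ₑ ^ 2) (f := fun p : E × ℝ => p.1 + p.2 • v)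
      (by fun_prop)
  have hin (τ : ℝ) (hτ : τ ∈ Icc (0 : ℝ) 1) :
      ∫⁻ y in A, ‖fderiv ℝ φ (y + τ • v)‖ₑ ^ 2 ≤ ∫⁻ y in Ω, ‖fderiv ℝ φ y‖ₑ ^ 2 := by
    rw [← lintegral_indicator hA, ← lintegral_indicator hΩ,
      ← lintegral_add_right_eq_self (Ω.indicator _) (τ • v)]
    refine lintegral_mono fun y => ?_
    by_cases hy : y ∈ A
    · simp [hy, h y hy τ hτ]
    · simp [hy]
  calc ∫⁻ y in A, ‖φ (y + v)‖ₑ ^ 2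
      ≤ ∫⁻ y in A, 2 * (‖φ y‖ₑ ^ 2 +
          ‖v‖ₑ ^ 2 * ∫⁻ τ in Icc (0 : ℝ) 1, ‖fderiv ℝ φ (y + τ • v)‖ₑ ^ 2) := by
        refine lintegral_mono fun y => ?_
        simpa using sq_enorm_line_le hφ y v (ρ := 1) (s := 0) (t := 1) (by simp) (by simp)
    _ = 2 * ((∫⁻ y in A, ‖φ y‖ₑ ^ 2) + ‖v‖ₑ ^ 2 *
          ∫⁻ τ in Icc (0 : ℝ) 1, ∫⁻ y in A, ‖fderiv ℝ φ (y + τ • v)‖ₑ ^ 2) := by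
        rw [lintegral_const_mul' _ _ (by simp), lintegral_add_left hmφ,
          lintegral_const_mul' _ _ (by simp), lintegral_lintegral_swap hm2.aemeasurable]
    _ ≤ _ := by
        gcongr
        refine (setLIntegral_mono' measurableSet_Icc hin).trans ?_
        simp

end Euclidean

/-! ### Coordinates straightening a graph, and surface measure on it. -/

section GraphCoordinates

variable {E : Type*} [NormedAddCommGroup E] [InnerProductSpace ℝ E]

theorem inner_unit_orthogonal {e : E} (y : (ℝ ∙ e)ᗮ) : inner ℝ e (y : E) = 0 :=
  Submodule.mem_orthogonal_singleton_iff_inner_right.1 y.2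

theorem coe_orthogonalProjectionOnto_unit {e : E} (he : ‖e‖ = 1) (z : E) :
    ((ℝ ∙ e)ᗮ.orthogonalProjectionOnto z : E) = z - inner ℝ e z • e := by
  have h := (ℝ ∙ e).starProjection_add_starProjection_orthogonal z
  rw [Submodule.starProjection_unit_singleton ℝ he] at h
  exact eq_sub_of_add_eq' h

theorem orthogonalProjectionOnto_add_smul {e : E} (y : (ℝ ∙ e)ᗮ) (s : ℝ) :
    (ℝ ∙ e)ᗮ.orthogonalProjectionOnto ((y : E) + s • e) = y := by
  have h : (ℝ ∙ e)ᗮ.orthogonalProjectionOnto (s • e) = 0 := by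
    rw [Submodule.orthogonalProjectionOnto_eq_zero_iff, Submodule.orthogonal_orthogonal]
    exact Submodule.smul_mem _ _ (Submodule.mem_span_singleton_self e)
  rw [map_add, h, add_zero, Submodule.orthogonalProjectionOnto_mem_subspace_eq_self]

/-- Coordinates adapted to the graph of `γ` over the hyperplane orthogonal to `e`. -/
noncomputable def graphHomeo (e : E) (he : ‖e‖ = 1) (γ : E → ℝ) (hγ : Continuous γ) :
    (ℝ ∙ e)ᗮ × ℝ ≃ₜ E where
  toFun p := (p.1 : E) + (γ p.1 + p.2) • e
  invFun z := ((ℝ ∙ e)ᗮ.orthogonalProjectionOnto z,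
    inner ℝ e z - γ ((ℝ ∙ e)ᗮ.orthogonalProjectionOnto z))
  left_inv p := by
    ext1
    · simp only [orthogonalProjectionOnto_add_smul]
    · simp only [orthogonalProjectionOnto_add_smul]
      rw [inner_add_right, inner_unit_orthogonal, inner_smul_right, real_inner_self_eq_norm_sq, he]
      ring
  right_inv z := by
    simp only [coe_orthogonalProjectionOnto_unit he]
    module
  continuous_toFun := by fun_prop
  continuous_invFun := by fun_prop

variable {e : E} (he : ‖e‖ = 1) {γ : E → ℝ} (hγ : Continuous γ)

theorem graphHomeo_apply (y : (ℝ ∙ e)ᗮ) (t : ℝ) :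
    graphHomeo e he γ hγ (y, t) = (y : E) + (γ y + t) • e := rfl

theorem graphHomeo_apply_eq_add (y : (ℝ ∙ e)ᗮ) (t : ℝ) :
    graphHomeo e he γ hγ (y, t) = graphHomeo e he γ hγ (y, 0) + t • e := by
  simp only [graphHomeo_apply]
  module

theorem inner_graphHomeo (y : (ℝ ∙ e)ᗮ) (t : ℝ) :
    inner ℝ e (graphHomeo e he γ hγ (y, t)) = γ y + t := by
  rw [graphHomeo_apply, inner_add_right, inner_unit_orthogonal, inner_smul_right,
    real_inner_self_eq_norm_sq, he]
  ring

theorem graphHomeo_sub_inner (y : (ℝ ∙ e)ᗮ) (t : ℝ) :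
    graphHomeo e he γ hγ (y, t) - inner ℝ e (graphHomeo e he γ hγ (y, t)) • e = y := by
  rw [inner_graphHomeo, graphHomeo_apply]
  module

theorem finrank_orthogonal_unit [FiniteDimensional ℝ E] (he : ‖e‖ = 1) :
    Module.finrank ℝ (ℝ ∙ e)ᗮ = Module.finrank ℝ E - 1 := by
  have h := (ℝ ∙ e).finrank_add_finrank_orthogonal
  rw [finrank_span_singleton (by rintro rfl; simp at he)] at h
  omega

theorem continuous_graph : Continuous fun y => graphHomeo e he γ hγ (y, 0) :=
  (graphHomeo e he γ hγ).continuous.comp (by fun_prop)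

variable [FiniteDimensional ℝ E] [MeasurableSpace E] [BorelSpace E]

/-- The map factors into a shear, a swap, the unit-speed parametrisation of the line `ℝ ∙ e`, and
the orthogonal decomposition of `E`; each factor preserves Lebesgue measure. -/
theorem measurePreserving_graphHomeo :
    MeasurePreserving (graphHomeo e he γ hγ) := by
  have h1 : MeasurePreserving (fun p : (ℝ ∙ e)ᗮ × ℝ => (p.1, γ p.1 + p.2)) :=
    (MeasurePreserving.id (volume : Measure (ℝ ∙ e)ᗮ)).skew_product
      (g := fun y t => γ (y : E) + t) (μc := volume) (μd := volume)
      (by fun_prop)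
      (Eventually.of_forall fun y => map_add_left_eq_self volume (γ (y : E)))
  have h2 : MeasurePreserving (Prod.swap : (ℝ ∙ e)ᗮ × ℝ → ℝ × (ℝ ∙ e)ᗮ) :=
    Measure.measurePreserving_swap
  have h3 : MeasurePreserving (Prod.map (LinearIsometryEquiv.toSpanUnitSingleton (𝕜 := ℝ) e he)
      (id : (ℝ ∙ e)ᗮ → (ℝ ∙ e)ᗮ)) :=
    (LinearIsometryEquiv.measurePreserving _).prod (MeasurePreserving.id _)
  have h4 := ((ℝ ∙ e).measurePreserving_measurableEquivProd (0 : E)).symm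
  rw [InnerProductSpace.euclideanHausdorffMeasure_eq_volume] at h4
  convert h4.comp (h3.comp (h2.comp h1)) using 1
  ext p
  simp [graphHomeo, add_comm]

/-- The hypersurface measure of a Lipschitz graph is at most a multiple of the Lebesgue measure
of its base. -/
theorem euclideanHausdorffMeasure_graph_le {L : NNReal} {D : Set (ℝ ∙ e)ᗮ}
    (hL : LipschitzOnWith L (fun y => graphHomeo e he γ hγ (y, 0)) D) {D' : Set (ℝ ∙ e)ᗮ}
    (hD' : D' ⊆ D) :
    μHE[Module.finrank ℝ E - 1] ((fun y => graphHomeo e he γ hγ (y, 0)) '' D') ≤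
      (L : ℝ≥0∞) ^ (Module.finrank ℝ E - 1) * volume D' := by
  rw [← InnerProductSpace.euclideanHausdorffMeasure_eq_volume, finrank_orthogonal_unit he,
    Measure.euclideanHausdorffMeasure_def, Measure.euclideanHausdorffMeasure_def]
  simp only [Measure.smul_apply, ENNReal.smul_def, smul_eq_mul]
  rw [mul_left_comm]
  gcongr
  have := (hL.mono hD').hausdorffMeasure_image_le (d := ((Module.finrank ℝ E - 1 : ℕ) : ℝ))
    (by positivity)
  simpa using this

/-- The Lebesgue measure of the base of a graph is at most its hypersurface measure. -/
theorem volume_le_euclideanHausdorffMeasure_graph (D : Set (ℝ ∙ e)ᗮ) :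
    volume D ≤
      μHE[Module.finrank ℝ E - 1] ((fun y => graphHomeo e he γ hγ (y, 0)) '' D) := by
  rw [← InnerProductSpace.euclideanHausdorffMeasure_eq_volume, finrank_orthogonal_unit he,
    Measure.euclideanHausdorffMeasure_def, Measure.euclideanHausdorffMeasure_def]
  simp only [Measure.smul_apply, ENNReal.smul_def, smul_eq_mul]
  gcongr
  -- The projection along `e` is 1-Lipschitz and maps the graph back onto its base.
  have := (ℝ ∙ e)ᗮ.lipschitzWith_orthogonalProjectionOnto.hausdorffMeasure_image_le
    (d := ((Module.finrank ℝ E - 1 : ℕ) : ℝ)) (by positivity)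
    ((fun y => graphHomeo e he γ hγ (y, 0)) '' D)
  rw [image_image] at this
  simpa [graphHomeo_apply, orthogonalProjectionOnto_add_smul] using this

/-- Comparability of surface measure with the pushforward of Lebesgue measure is enough here, so the
Lipschitz bound on measures replaces the exact area formula. -/
theorem lintegral_graph_le {L : NNReal} {D : Set (ℝ ∙ e)ᗮ}
    (hL : LipschitzOnWith L (fun y => graphHomeo e he γ hγ (y, 0)) D) {S : Set E}
    (hS : S ⊆ (fun y => graphHomeo e he γ hγ (y, 0)) '' D) {f : E → ℝ≥0∞} (hf : Measurable f) :
    ∫⁻ x in S, f x ∂μHE[Module.finrank ℝ E - 1] ≤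
      (L : ℝ≥0∞) ^ (Module.finrank ℝ E - 1) *
        ∫⁻ y in D, f (graphHomeo e he γ hγ (y, 0)) := by
  have hG := (continuous_graph he hγ).measurable
  have hle : μHE[Module.finrank ℝ E - 1].restrict S ≤ (L : ℝ≥0∞) ^ (Module.finrank ℝ E - 1) •
      (volume.restrict D).map (fun y => graphHomeo e he γ hγ (y, 0)) := by
    refine Measure.le_iff.2 fun T hT => ?_
    rw [Measure.restrict_apply hT, Measure.smul_apply, Measure.map_apply hG hT,
      Measure.restrict_apply (hG hT), smul_eq_mul]
    refine le_trans (measure_mono ?_)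
      (euclideanHausdorffMeasure_graph_le he hγ hL (D' := _ ∩ D) inter_subset_right)
    rintro x ⟨hxT, hxS⟩
    obtain ⟨y, hy, rfl⟩ := hS hxS
    exact ⟨y, ⟨hxT, hy⟩, rfl⟩
  refine (lintegral_mono' hle le_rfl).trans ?_
  rw [lintegral_smul_measure, lintegral_map hf hG, smul_eq_mul]

theorem lintegral_base_le {D : Set (ℝ ∙ e)ᗮ} {S : Set E}
    (hS : (fun y => graphHomeo e he γ hγ (y, 0)) '' D ⊆ S) {f : E → ℝ≥0∞} (hf : Measurable f) :
    ∫⁻ y in D, f (graphHomeo e he γ hγ (y, 0)) ≤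
      ∫⁻ x in S, f x ∂μHE[Module.finrank ℝ E - 1] := by
  have hG := (continuous_graph he hγ).measurable
  have hle : (volume.restrict D).map (fun y => graphHomeo e he γ hγ (y, 0)) ≤
      μHE[Module.finrank ℝ E - 1].restrict S := by
    refine Measure.le_iff.2 fun T hT => ?_
    rw [Measure.restrict_apply hT, Measure.map_apply hG hT, Measure.restrict_apply (hG hT)]
    refine (volume_le_euclideanHausdorffMeasure_graph he hγ _).trans (measure_mono ?_)
    rintro _ ⟨y, ⟨hyT, hyD⟩, rfl⟩
    exact ⟨hyT, hS ⟨y, hyD, rfl⟩⟩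
  rw [← lintegral_map hf hG]
  exact lintegral_mono' hle le_rfl

/-- Fubini's theorem in graph coordinates. -/
theorem setLIntegral_graphHomeo {D : Set (ℝ ∙ e)ᗮ} {I : Set ℝ} {f : E → ℝ≥0∞}
    (hf : Measurable f) :
    ∫⁻ x in graphHomeo e he γ hγ '' (D ×ˢ I), f x =
      ∫⁻ y in D, ∫⁻ t in I, f (graphHomeo e he γ hγ (y, t)) := by
  have hm := (graphHomeo e he γ hγ).measurableEmbedding
  rw [← (measurePreserving_graphHomeo he hγ).setLIntegral_comp_preimage_emb hm,
    (graphHomeo e he γ hγ).injective.preimage_image, Measure.volume_eq_prod,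
    setLIntegral_prod (fun p => f (graphHomeo e he γ hγ p)) (hf.comp (graphHomeo e he γ hγ).continuous.measurable).aemeasurable]

end GraphCoordinates

/-! ### Segments issuing from the boundary, and sweeping by translations. -/

section Euclidean

variable {E : Type*} [NormedAddCommGroup E] [InnerProductSpace ℝ E]

/-- The base point controls the segment: the source of the Poincaré inequality near `Γ₀`. -/
theorem lintegral_line_le {φ : E → ℝ} (hφ : ContDiff ℝ 1 φ) (y : E) {e : E}
    (he : ‖e‖ = 1) {ρ : ℝ} (hρ : 0 < ρ) :
    ∫⁻ t in Ioo 0 ρ, ‖φ (y + t • e)‖ₑ ^ 2 ≤ 2 * (ENNReal.ofReal ρ * ‖φ y‖ₑ ^ 2 +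
      ENNReal.ofReal ρ ^ 2 * ∫⁻ t in Ioo 0 ρ, ‖fderiv ℝ φ (y + t • e)‖ₑ ^ 2) := by
  rw [Measure.restrict_congr_set Ioo_ae_eq_Icc]
  set Q := ∫⁻ t in Icc 0 ρ, ‖fderiv ℝ φ (y + t • e)‖ₑ ^ 2
  calc ∫⁻ t in Icc 0 ρ, ‖φ (y + t • e)‖ₑ ^ 2
      ≤ ∫⁻ t in Icc 0 ρ, 2 * (‖φ y‖ₑ ^ 2 + ENNReal.ofReal ρ * Q) := by
        refine setLIntegral_mono' measurableSet_Icc fun t ht => ?_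
        simpa [← ofReal_norm e, he] using
          sq_enorm_line_le hφ y e (s := 0) (left_mem_Icc.2 hρ.le) ht
    _ = _ := by
        simp only [lintegral_const, Measure.restrict_apply_univ, Real.volume_Icc, sub_zero]
        ring

/-- The segment controls its base point, by averaging over the other endpoint: the source of the
trace inequality. -/
theorem ofReal_mul_sq_enorm_le_lintegral_line {φ : E → ℝ} (hφ : ContDiff ℝ 1 φ) (y : E) {e : E}
    (he : ‖e‖ = 1) {ρ : ℝ} (hρ : 0 < ρ) :
    ENNReal.ofReal ρ * ‖φ y‖ₑ ^ 2 ≤ 2 * ((∫⁻ t in Ioo 0 ρ, ‖φ (y + t • e)‖ₑ ^ 2) +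
      ENNReal.ofReal ρ ^ 2 * ∫⁻ t in Ioo 0 ρ, ‖fderiv ℝ φ (y + t • e)‖ₑ ^ 2) := by
  have hc : Measurable fun t : ℝ => ‖φ (y + t • e)‖ₑ ^ 2 :=
    ((contDiff_line hφ y e).continuous.enorm.measurable).pow_const 2
  rw [Measure.restrict_congr_set Ioo_ae_eq_Icc]
  set Q := ∫⁻ t in Icc 0 ρ, ‖fderiv ℝ φ (y + t • e)‖ₑ ^ 2
  calc ENNReal.ofReal ρ * ‖φ y‖ₑ ^ 2 = ∫⁻ t in Icc 0 ρ, ‖φ y‖ₑ ^ 2 := by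
        simp [mul_comm]
    _ ≤ ∫⁻ t in Icc 0 ρ, 2 * (‖φ (y + t • e)‖ₑ ^ 2 + ENNReal.ofReal ρ * Q) := by
        refine setLIntegral_mono' measurableSet_Icc fun t ht => ?_
        simpa [← ofReal_norm e, he] using
          sq_enorm_line_le hφ y e (s := t) (t := 0) ht (left_mem_Icc.2 hρ.le)
    _ = _ := by
        rw [lintegral_const_mul' _ _ (by simp), lintegral_add_left hc]
        simp only [lintegral_const, Measure.restrict_apply_univ, Real.volume_Icc, sub_zero]
        ring

variable [MeasurableSpace E] [BorelSpace E] [FiniteDimensional ℝ E]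

/-- Control of the `L²` norm on `B` by the one on `B - v` when the swept region lies in `Ω`. -/
theorem lintegral_sq_le_of_sweep {φ : E → ℝ} (hφ : ContDiff ℝ 1 φ) {B Ω : Set E}
    (hB : MeasurableSet B) (hΩ : MeasurableSet Ω) (v : E)
    (h : ∀ y ∈ B, ∀ t ∈ Icc (0 : ℝ) 1, y - t • v ∈ Ω) :
    ∫⁻ y in B, ‖φ y‖ₑ ^ 2 ≤
      2 * ((∫⁻ y in (· + v) ⁻¹' B, ‖φ y‖ₑ ^ 2) + ‖v‖ₑ ^ 2 * ∫⁻ y in Ω, ‖fderiv ℝ φ y‖ₑ ^ 2) := by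
  have hA : MeasurableSet ((· + v) ⁻¹' B) := measurable_add_const v hB
  refine le_trans (le_of_eq ?_) (lintegral_sq_translate_le hφ hA hΩ v fun y hy t ht => ?_)
  · exact ((measurePreserving_add_right volume v).setLIntegral_comp_preimage hB
      (hφ.continuous.enorm.measurable.pow_const 2)).symm
  · convert h _ hy (1 - t) ⟨by linarith [ht.2], by linarith [ht.1]⟩ using 1
    module

end Euclidean

/-! ### Boundary charts and the local estimates in them. -/

section Charts

variable {n : ℕ} {Ω : Set (EuclideanSpace ℝ (Fin n))}

/-- In a graph chart, `Ω` is the region above the graph and `∂Ω` is the graph. -/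
theorem mem_frontier_graphHomeo_iff (hΩ : IsOpen Ω) {x e : EuclideanSpace ℝ (Fin n)}
    {γ : EuclideanSpace ℝ (Fin n) → ℝ} {r : ℝ} (he : ‖e‖ = 1) (hγ : Continuous γ)
    (h : ∀ y ∈ Metric.ball x r, y ∈ Ω ↔ γ (y - inner ℝ e y • e) < inner ℝ e y)
    {p : (ℝ ∙ e)ᗮ × ℝ} (hp : graphHomeo e he γ hγ p ∈ Metric.ball x r) :
    (graphHomeo e he γ hγ p ∈ Ω ↔ 0 < p.2) ∧
      (graphHomeo e he γ hγ p ∈ frontier Ω ↔ p.2 = 0) := by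
  have key : ∀ q : (ℝ ∙ e)ᗮ × ℝ, graphHomeo e he γ hγ q ∈ Metric.ball x r →
      (graphHomeo e he γ hγ q ∈ Ω ↔ 0 < q.2) := by
    rintro ⟨y, t⟩ hq
    rw [h _ hq, graphHomeo_sub_inner, inner_graphHomeo]
    simp
  refine ⟨key p hp, ?_, ?_⟩
  · rw [hΩ.frontier_eq]
    rintro ⟨hcl, hnot⟩
    rw [key p hp, not_lt] at hnot
    by_contra hne
    have hlt : p.2 < 0 := lt_of_le_of_ne hnot hne
    -- A point strictly below the graph has a neighbourhood missing `Ω`, so it is not in `closure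
    -- Ω`.
    have hopen : IsOpen (graphHomeo e he γ hγ '' {q | q.2 < 0} ∩ Metric.ball x r) :=
      ((graphHomeo e he γ hγ).isOpenMap _ (isOpen_lt (by fun_prop) (by fun_prop))).inter
        Metric.isOpen_ball
    obtain ⟨z, ⟨⟨q, hq, rfl⟩, hqb⟩, hqΩ⟩ :=
      mem_closure_iff.1 hcl _ hopen ⟨mem_image_of_mem _ hlt, hp⟩
    exact lt_asymm hq ((key q hqb).1 hqΩ)
  · intro h0
    rw [hΩ.frontier_eq]
    refine ⟨?_, by rw [key p hp, h0]; exact lt_irrefl _⟩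
    have hcont : Continuous fun t : ℝ => graphHomeo e he γ hγ (p.1, t) :=
      (graphHomeo e he γ hγ).continuous.comp (by fun_prop)
    have ht : Tendsto (fun t : ℝ => graphHomeo e he γ hγ (p.1, t)) (𝓝[>] 0)
        (𝓝 (graphHomeo e he γ hγ p)) := by
      have := hcont.tendsto 0
      have hp0 : p = (p.1, 0) := Prod.ext rfl h0
      rw [hp0]
      exact this.mono_left nhdsWithin_le_nhds
    refine mem_closure_of_tendsto ht ?_
    filter_upwards [ht (Metric.isOpen_ball.mem_nhds hp), self_mem_nhdsWithin] with t hb ht0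
    exact (key _ hb).2 ht0

/-- A boundary chart: a graph cylinder around a boundary point inside a prescribed
neighbourhood. -/
theorem exists_graph_chart (hΩ : IsOpen Ω) (hC1 : HasC1Boundary Ω)
    {x : EuclideanSpace ℝ (Fin n)} (hx : x ∈ frontier Ω) {W : Set (EuclideanSpace ℝ (Fin n))}
    (hW : W ∈ 𝓝 x) :
    ∃ (e : EuclideanSpace ℝ (Fin n)) (he : ‖e‖ = 1) (γ : EuclideanSpace ℝ (Fin n) → ℝ)
      (hγ : Continuous γ) (D : Set (ℝ ∙ e)ᗮ) (ρ : ℝ) (L : NNReal), 0 < ρ ∧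
      LipschitzOnWith L (fun y => graphHomeo e he γ hγ (y, 0)) D ∧
      graphHomeo e he γ hγ '' (D ×ˢ Ioo (-ρ) ρ) ∈ 𝓝 x ∧
      graphHomeo e he γ hγ '' (D ×ˢ Ioo (-ρ) ρ) ⊆ W ∧
      ∀ y ∈ D, ∀ t ∈ Ioo (-ρ) ρ, (graphHomeo e he γ hγ (y, t) ∈ Ω ↔ 0 < t) ∧
        (graphHomeo e he γ hγ (y, t) ∈ frontier Ω ↔ t = 0) := by
  obtain ⟨e, γ, r, he, hγ1, hr, h⟩ := hC1 x hx
  have hγ := hγ1.continuous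
  obtain ⟨⟨y₀, t₀⟩, rfl⟩ := (graphHomeo e he γ hγ).surjective x
  obtain rfl : t₀ = 0 :=
    (mem_frontier_graphHomeo_iff hΩ he hγ h (Metric.mem_ball_self hr)).2.1 hx
  have hn : graphHomeo e he γ hγ ⁻¹' (W ∩ Metric.ball (graphHomeo e he γ hγ (y₀, 0)) r) ∈
      𝓝 (y₀, (0 : ℝ)) :=
    (graphHomeo e he γ hγ).continuous.continuousAt.preimage_mem_nhds
      (inter_mem hW (Metric.ball_mem_nhds _ hr))
  obtain ⟨δ, hδ, hsub⟩ := Metric.mem_nhds_iff.1 hn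
  rw [← ball_prod_same, Real.ball_eq_Ioo, zero_sub, zero_add] at hsub
  have hL : ContDiffOn ℝ 1 (fun y => graphHomeo e he γ hγ (y, 0)) (Metric.closedBall y₀ δ) := by
    have hc : ContDiff ℝ 1 fun y : (ℝ ∙ e)ᗮ => (y : EuclideanSpace ℝ (Fin n)) :=
      (ℝ ∙ e)ᗮ.subtypeL.contDiff
    exact (hc.add (((hγ1.comp hc).add contDiff_const).smul contDiff_const)).contDiffOn
  obtain ⟨L, hL⟩ := hL.exists_lipschitzOnWith one_ne_zero (convex_closedBall _ _)
    (isCompact_closedBall _ _)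
  refine ⟨e, he, γ, hγ, Metric.ball y₀ δ, δ, L, hδ, hL.mono Metric.ball_subset_closedBall,
    ?_, ?_, ?_⟩
  · refine ((graphHomeo e he γ hγ).isOpenMap _ (Metric.isOpen_ball.prod isOpen_Ioo)).mem_nhds ?_
    exact mem_image_of_mem _ ⟨Metric.mem_ball_self hδ, by constructor <;> simpa⟩
  · rintro _ ⟨p, hp, rfl⟩
    exact (hsub hp).1
  · intro y hy t ht
    exact mem_frontier_graphHomeo_iff hΩ he hγ h (hsub (mk_mem_prod hy ht)).2

/-- Compare each boundary value with the segment of length `ρ` above it, then integrate over the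
base by Fubini. In the constant, `L ^ (n - 1)` passes from surface measure to the base and `ρ⁻¹`
comes from averaging. -/
theorem exists_local_trace_bound (hΩ : IsOpen Ω) (hC1 : HasC1Boundary Ω)
    {x : EuclideanSpace ℝ (Fin n)} (hx : x ∈ frontier Ω) :
    ∃ N ∈ 𝓝 x, ∃ C : ℝ≥0∞, C ≠ ⊤ ∧ ∀ φ : EuclideanSpace ℝ (Fin n) → ℝ, ContDiff ℝ 1 φ →
      ∫⁻ z in N, ‖φ z‖ₑ ^ 2 ∂surfaceMeasure Ω ≤
        C * ((∫⁻ z in Ω, ‖φ z‖ₑ ^ 2) + ∫⁻ z in Ω, ‖fderiv ℝ φ z‖ₑ ^ 2) := by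
  obtain ⟨e, he, γ, hγ, D, ρ, L, hρ, hL, hN, -, hΨ⟩ :=
    exists_graph_chart hΩ hC1 hx (W := univ) univ_mem
  have hρ' : ENNReal.ofReal ρ ≠ 0 := by simpa using hρ
  refine ⟨_, hN, (L : ℝ≥0∞) ^ (n - 1) * ((ENNReal.ofReal ρ)⁻¹ * (2 * (1 + ENNReal.ofReal ρ ^ 2))),
    by finiteness, fun φ hφ => ?_⟩
  have hm : Measurable fun z => ‖φ z‖ₑ ^ 2 := hφ.continuous.enorm.measurable.pow_const 2
  have hmd := measurable_sq_enorm_fderiv hφ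
  have hsub : graphHomeo e he γ hγ '' (D ×ˢ Ioo 0 ρ) ⊆ Ω := by
    rintro _ ⟨⟨y, t⟩, ⟨hy, ht⟩, rfl⟩
    exact (hΨ y hy t ⟨by linarith [ht.1], ht.2⟩).1.2 ht.1
  have hgraph : graphHomeo e he γ hγ '' (D ×ˢ Ioo (-ρ) ρ) ∩ frontier Ω ⊆
      (fun y => graphHomeo e he γ hγ (y, 0)) '' D := by
    rintro _ ⟨⟨⟨y, t⟩, ⟨hy, ht⟩, rfl⟩, hf⟩
    obtain rfl := (hΨ y hy t ht).2.1 hf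
    exact ⟨y, hy, rfl⟩
  have h1 := lintegral_graph_le he hγ hL hgraph hm
  rw [finrank_euclideanSpace_fin] at h1
  have h2 : ENNReal.ofReal ρ * ∫⁻ y in D, ‖φ (graphHomeo e he γ hγ (y, 0))‖ₑ ^ 2 ≤
      2 * ((∫⁻ z in Ω, ‖φ z‖ₑ ^ 2) +
        ENNReal.ofReal ρ ^ 2 * ∫⁻ z in Ω, ‖fderiv ℝ φ z‖ₑ ^ 2) := by
    calc _ = ∫⁻ y in D, ENNReal.ofReal ρ * ‖φ (graphHomeo e he γ hγ (y, 0))‖ₑ ^ 2 :=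
          (lintegral_const_mul' _ _ (by simp)).symm
      _ ≤ ∫⁻ y in D, 2 * ((∫⁻ t in Ioo 0 ρ, ‖φ (graphHomeo e he γ hγ (y, t))‖ₑ ^ 2) +
            ENNReal.ofReal ρ ^ 2 *
              ∫⁻ t in Ioo 0 ρ, ‖fderiv ℝ φ (graphHomeo e he γ hγ (y, t))‖ₑ ^ 2) := by
          refine lintegral_mono fun y => ?_
          simpa only [← graphHomeo_apply_eq_add] using
            ofReal_mul_sq_enorm_le_lintegral_line hφ (graphHomeo e he γ hγ (y, 0)) he hρ
      _ = 2 * ((∫⁻ z in graphHomeo e he γ hγ '' (D ×ˢ Ioo 0 ρ), ‖φ z‖ₑ ^ 2) +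
            ENNReal.ofReal ρ ^ 2 *
              ∫⁻ z in graphHomeo e he γ hγ '' (D ×ˢ Ioo 0 ρ), ‖fderiv ℝ φ z‖ₑ ^ 2) := by
          rw [lintegral_const_mul' _ _ (by simp), lintegral_add_left,
            lintegral_const_mul' _ _ (by finiteness), setLIntegral_graphHomeo he hγ hm,
            setLIntegral_graphHomeo he hγ hmd]
          exact (hm.comp (graphHomeo e he γ hγ).continuous.measurable).lintegral_prod_right'
      _ ≤ _ := by gcongr
  have h3 := ENNReal.mul_le_iff_le_inv hρ' ENNReal.ofReal_ne_top |>.1 h2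
  rw [surfaceMeasure, Measure.restrict_restrict' isClosed_frontier.measurableSet]
  refine h1.trans ?_
  rw [mul_assoc]
  gcongr
  refine h3.trans ?_
  rw [mul_assoc, mul_assoc]
  gcongr
  rw [add_mul, mul_add, mul_add]
  gcongr
  · rw [one_mul]; exact le_self_add
  · exact le_add_self

/-- The segments are now controlled by their boundary points. No Lipschitz constant enters, since
projecting to the base only shrinks measure. Choosing `W` away from `Γ₁` will put the boundary term
on `Γ₀`. -/
theorem exists_local_boundary_poincare (hΩ : IsOpen Ω) (hC1 : HasC1Boundary Ω)
    {x : EuclideanSpace ℝ (Fin n)} (hx : x ∈ frontier Ω) {W : Set (EuclideanSpace ℝ (Fin n))}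
    (hW : W ∈ 𝓝 x) :
    ∃ N ∈ 𝓝 x, ∃ C : ℝ≥0∞, C ≠ ⊤ ∧ ∀ φ : EuclideanSpace ℝ (Fin n) → ℝ, ContDiff ℝ 1 φ →
      ∫⁻ z in N ∩ Ω, ‖φ z‖ₑ ^ 2 ≤
        C * ((∫⁻ z in Ω, ‖fderiv ℝ φ z‖ₑ ^ 2) + ∫⁻ z in W, ‖φ z‖ₑ ^ 2 ∂surfaceMeasure Ω) := by
  obtain ⟨e, he, γ, hγ, D, ρ, L, hρ, hL, hN, hNW, hΨ⟩ := exists_graph_chart hΩ hC1 hx hW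
  refine ⟨_, hN, 2 * (ENNReal.ofReal ρ + ENNReal.ofReal ρ ^ 2), by finiteness, fun φ hφ => ?_⟩
  have hm : Measurable fun z => ‖φ z‖ₑ ^ 2 := hφ.continuous.enorm.measurable.pow_const 2
  have hmd := measurable_sq_enorm_fderiv hφ
  have hsub : graphHomeo e he γ hγ '' (D ×ˢ Ioo 0 ρ) ⊆ Ω := by
    rintro _ ⟨⟨y, t⟩, ⟨hy, ht⟩, rfl⟩
    exact (hΨ y hy t ⟨by linarith [ht.1], ht.2⟩).1.2 ht.1
  have hcyl : graphHomeo e he γ hγ '' (D ×ˢ Ioo (-ρ) ρ) ∩ Ω ⊆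
      graphHomeo e he γ hγ '' (D ×ˢ Ioo 0 ρ) := by
    rintro _ ⟨⟨⟨y, t⟩, ⟨hy, ht⟩, rfl⟩, hf⟩
    exact ⟨(y, t), ⟨hy, (hΨ y hy t ht).1.1 hf, ht.2⟩, rfl⟩
  have hgraph : (fun y => graphHomeo e he γ hγ (y, 0)) '' D ⊆ W ∩ frontier Ω := by
    rintro _ ⟨y, hy, rfl⟩
    have h0 : (0 : ℝ) ∈ Ioo (-ρ) ρ := ⟨by linarith, hρ⟩
    exact ⟨hNW ⟨(y, 0), ⟨hy, h0⟩, rfl⟩, (hΨ y hy 0 h0).2.2 rfl⟩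
  have h1 := lintegral_base_le he hγ hgraph hm
  rw [finrank_euclideanSpace_fin] at h1
  rw [surfaceMeasure, Measure.restrict_restrict' isClosed_frontier.measurableSet]
  calc ∫⁻ z in graphHomeo e he γ hγ '' (D ×ˢ Ioo (-ρ) ρ) ∩ Ω, ‖φ z‖ₑ ^ 2
      ≤ ∫⁻ z in graphHomeo e he γ hγ '' (D ×ˢ Ioo 0 ρ), ‖φ z‖ₑ ^ 2 := lintegral_mono_set hcyl
    _ = ∫⁻ y in D, ∫⁻ t in Ioo 0 ρ, ‖φ (graphHomeo e he γ hγ (y, t))‖ₑ ^ 2 :=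
        setLIntegral_graphHomeo he hγ hm
    _ ≤ ∫⁻ y in D, 2 * (ENNReal.ofReal ρ * ‖φ (graphHomeo e he γ hγ (y, 0))‖ₑ ^ 2 +
          ENNReal.ofReal ρ ^ 2 *
            ∫⁻ t in Ioo 0 ρ, ‖fderiv ℝ φ (graphHomeo e he γ hγ (y, t))‖ₑ ^ 2) := by
        refine lintegral_mono fun y => ?_
        simpa only [← graphHomeo_apply_eq_add] using
          lintegral_line_le hφ (graphHomeo e he γ hγ (y, 0)) he hρ
    _ = 2 * (ENNReal.ofReal ρ * (∫⁻ y in D, ‖φ (graphHomeo e he γ hγ (y, 0))‖ₑ ^ 2) +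
          ENNReal.ofReal ρ ^ 2 *
            ∫⁻ z in graphHomeo e he γ hγ '' (D ×ˢ Ioo 0 ρ), ‖fderiv ℝ φ z‖ₑ ^ 2) := by
        rw [lintegral_const_mul' _ _ (by simp), lintegral_add_left,
          lintegral_const_mul' _ _ (by finiteness), lintegral_const_mul' _ _ (by finiteness),
          setLIntegral_graphHomeo he hγ hmd]
        exact (hm.comp (continuous_graph he hγ).measurable).const_mul _
    _ ≤ 2 * (ENNReal.ofReal ρ * (∫⁻ z in W ∩ frontier Ω, ‖φ z‖ₑ ^ 2 ∂μHE[n - 1]) +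
          ENNReal.ofReal ρ ^ 2 * ∫⁻ z in Ω, ‖fderiv ℝ φ z‖ₑ ^ 2) := by
        gcongr
    _ ≤ _ := by
        rw [mul_assoc, add_mul (ENNReal.ofReal ρ)]
        gcongr
        · exact le_add_self
        · exact le_self_add

end Charts

/-! ### From local to global: the Poincaré and trace inequalities for `C¹` functions. -/

section

/-- Local integral bounds with a common right-hand side add up over a compact set. -/
theorem _root_.IsCompact.exists_setLIntegral_le {X ι : Type*} [TopologicalSpace X]
    [MeasurableSpace X] {μ : Measure X} {K : Set X} (hK : IsCompact K) (f : ι → X → ℝ≥0∞)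
    (g : ι → ℝ≥0∞)
    (h : ∀ x ∈ K, ∃ N ∈ 𝓝 x, ∃ C : ℝ≥0∞, C ≠ ⊤ ∧ ∀ i, ∫⁻ z in N, f i z ∂μ ≤ C * g i) :
    ∃ C : ℝ≥0∞, C ≠ ⊤ ∧ ∀ i, ∫⁻ z in K, f i z ∂μ ≤ C * g i := by
  refine hK.induction_on (p := fun s => ∃ C : ℝ≥0∞, C ≠ ⊤ ∧ ∀ i, ∫⁻ z in s, f i z ∂μ ≤ C * g i)
    ⟨0, by simp, by simp⟩ ?_ ?_ ?_
  · rintro s t hst ⟨C, hC, hb⟩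
    exact ⟨C, hC, fun i => (lintegral_mono_set hst).trans (hb i)⟩
  · rintro s t ⟨C, hC, hb⟩ ⟨C', hC', hb'⟩
    refine ⟨C + C', by finiteness, fun i => (lintegral_union_le _ _ _).trans ?_⟩
    rw [add_mul]
    gcongr
    exacts [hb i, hb' i]
  · intro x hx
    obtain ⟨N, hN, hb⟩ := h x hx
    exact ⟨N, mem_nhdsWithin_of_mem_nhds hN, hb⟩

variable {n : ℕ} {Ω Γ₀ Γ₁ : Set (EuclideanSpace ℝ (Fin n))}

/-- The Poincaré inequality, with boundary term on `Γ`, holds near `x`. -/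
def PoincareAt (Ω Γ : Set (EuclideanSpace ℝ (Fin n))) (x : EuclideanSpace ℝ (Fin n)) : Prop :=
  ∃ ε : ℝ, 0 < ε ∧ ∃ C : ℝ≥0∞, C ≠ ⊤ ∧ ∀ φ : EuclideanSpace ℝ (Fin n) → ℝ, ContDiff ℝ 1 φ →
    ∫⁻ z in Metric.ball x ε ∩ Ω, ‖φ z‖ₑ ^ 2 ≤
      C * ((∫⁻ z in Ω, ‖fderiv ℝ φ z‖ₑ ^ 2) + ∫⁻ z in Γ, ‖φ z‖ₑ ^ 2 ∂surfaceMeasure Ω)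

theorem isOpen_setOf_poincareAt (Ω Γ : Set (EuclideanSpace ℝ (Fin n))) :
    IsOpen {x | PoincareAt Ω Γ x} := by
  refine Metric.isOpen_iff.2 fun x ⟨ε, hε, C, hC, hb⟩ => ⟨ε / 2, by positivity, fun y hy => ?_⟩
  refine ⟨ε / 2, by positivity, C, hC, fun φ hφ => (lintegral_mono_set ?_).trans (hb φ hφ)⟩
  gcongr
  refine Metric.ball_subset_ball' ?_
  linarith [Metric.mem_ball.1 hy]

/-- The local Poincaré inequality propagates along a translation which keeps a neighbourhood
of `x` in `Ω`. -/
theorem PoincareAt.of_sweep (hΩ : IsOpen Ω) {Γ : Set (EuclideanSpace ℝ (Fin n))}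
    {x v : EuclideanSpace ℝ (Fin n)} {r : ℝ} (hr : 0 < r) (h : PoincareAt Ω Γ (x - v))
    (hs : ∀ y ∈ Metric.ball x r ∩ Ω, ∀ t ∈ Icc (0 : ℝ) 1, y - t • v ∈ Ω) :
    PoincareAt Ω Γ x := by
  obtain ⟨ε, hε, C, hC, hb⟩ := h
  refine ⟨min ε r, lt_min hε hr, 2 * (C + ‖v‖ₑ ^ 2), by finiteness, fun φ hφ => ?_⟩
  have hB : MeasurableSet (Metric.ball x (min ε r) ∩ Ω) :=
    (Metric.isOpen_ball.inter hΩ).measurableSet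
  have hsub : Metric.ball x (min ε r) ∩ Ω ⊆ Metric.ball x r ∩ Ω := by
    gcongr
    exact min_le_right _ _
  refine (lintegral_sq_le_of_sweep hφ hB hΩ.measurableSet v fun y hy => hs y (hsub hy)).trans ?_
  rw [mul_assoc, add_mul]
  gcongr
  · refine (lintegral_mono_set ?_).trans (hb φ hφ)
    intro y hy
    refine ⟨?_, by simpa using hs _ (hsub hy) 1 (by simp)⟩
    have h1 := Metric.ball_subset_ball (min_le_left ε r) hy.1
    rw [Metric.mem_ball, dist_eq_norm] at h1 ⊢
    convert h1 using 2
    exact (add_sub_right_comm y v x ▸ sub_sub_eq_add_sub y x v)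
  · exact le_self_add

/-- Translating by `x - z`, of length less than `r`, keeps the ball of radius `r` inside the one of
radius `2 * r`. -/
theorem PoincareAt.of_mem_ball (hΩ : IsOpen Ω) {Γ : Set (EuclideanSpace ℝ (Fin n))}
    {x z : EuclideanSpace ℝ (Fin n)} {r : ℝ} (hr : 0 < r) (hx : Metric.ball x (2 * r) ⊆ Ω)
    (hz : z ∈ Metric.ball x r) (h : PoincareAt Ω Γ z) : PoincareAt Ω Γ x := by
  refine PoincareAt.of_sweep hΩ (v := x - z) hr (by simpa using h) fun y hy t ht => hx ?_
  have h1 := Metric.mem_ball.1 hy.1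
  have h2 := Metric.mem_ball'.1 hz
  rw [dist_eq_norm] at h1 h2
  rw [Metric.mem_ball, dist_eq_norm]
  calc ‖y - t • (x - z) - x‖ = ‖(y - x) - t • (x - z)‖ := by congr 1; abel
    _ ≤ ‖y - x‖ + ‖t • (x - z)‖ := norm_sub_le _ _
    _ ≤ ‖y - x‖ + 1 * ‖x - z‖ := by
      rw [norm_smul, Real.norm_of_nonneg ht.1]
      gcongr
      exact ht.2
    _ < 2 * r := by linarith

/-- Near `x` the set `Ω` lies above a graph, so moving in direction `e` keeps its points in `Ω` and
takes `x` itself to an interior point, where the bound is known. -/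
theorem PoincareAt.of_mem_frontier (hΩ : IsOpen Ω) (hC1 : HasC1Boundary Ω)
    {Γ : Set (EuclideanSpace ℝ (Fin n))} (h : ∀ z ∈ Ω, PoincareAt Ω Γ z)
    {x : EuclideanSpace ℝ (Fin n)} (hx : x ∈ frontier Ω) : PoincareAt Ω Γ x := by
  obtain ⟨e, γ, r, he, hγ, hr, hg⟩ := hC1 x hx
  have hshift (y : EuclideanSpace ℝ (Fin n)) (s : ℝ) :
      inner ℝ e (y + s • e) = inner ℝ e y + s := by
    rw [inner_add_right, inner_smul_right, real_inner_self_eq_norm_sq, he]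
    ring
  have hproj (y : EuclideanSpace ℝ (Fin n)) (s : ℝ) :
      y + s • e - inner ℝ e (y + s • e) • e = y - inner ℝ e y • e := by
    rw [hshift]
    module
  have hx0 : γ (x - inner ℝ e x • e) = inner ℝ e x := by
    obtain ⟨⟨y, t⟩, rfl⟩ := (graphHomeo e he γ hγ.continuous).surjective x
    obtain rfl : t = 0 := (mem_frontier_graphHomeo_iff hΩ he hγ.continuous hg
      (Metric.mem_ball_self hr)).2.1 hx
    rw [graphHomeo_sub_inner, inner_graphHomeo, add_zero]
  have hball (y : EuclideanSpace ℝ (Fin n)) (s : ℝ) (hs : s ∈ Icc 0 (r / 2))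
      (hy : dist y x < r / 2) : y + s • e ∈ Metric.ball x r := by
    rw [Metric.mem_ball, dist_eq_norm]
    rw [dist_eq_norm] at hy
    calc ‖y + s • e - x‖ = ‖(y - x) + s • e‖ := by congr 1; abel
      _ ≤ ‖y - x‖ + ‖s • e‖ := norm_add_le _ _
      _ < r := by
        rw [norm_smul, he, Real.norm_of_nonneg hs.1]
        linarith [hs.2]
  refine PoincareAt.of_sweep hΩ (v := -((r / 2) • e)) (half_pos hr) (h _ ?_) ?_
  · rw [sub_neg_eq_add, hg _ (hball x _ ⟨by positivity, le_rfl⟩ (by simpa using hr)), hproj,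
      hshift, hx0]
    linarith
  · rintro y ⟨hy, hyΩ⟩ t ht
    have hyr : y ∈ Metric.ball x r := Metric.ball_subset_ball (by linarith) hy
    have hs : t * (r / 2) ∈ Icc 0 (r / 2) :=
      ⟨mul_nonneg ht.1 (by positivity), mul_le_of_le_one_left (by positivity) ht.2⟩
    rw [smul_neg, sub_neg_eq_add, smul_smul, hg _ (hball y _ hs hy), hproj, hshift]
    linarith [(hg y hyr).1 hyΩ, hs.1]

/-- As the closures are disjoint, a point of `Γ₀` has a neighbourhood in which `∂Ω` consists of `Γ₀`
alone. -/
theorem eventually_poincareAt_of_mem_frontier (hΩ : IsOpen Ω) (hC1 : HasC1Boundary Ω)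
    (hΓ : frontier Ω = Γ₀ ∪ Γ₁) (hd : closure Γ₀ ∩ closure Γ₁ = ∅)
    {x : EuclideanSpace ℝ (Fin n)} (hx : x ∈ Γ₀) : ∀ᶠ y in 𝓝 x, y ∈ Ω → PoincareAt Ω Γ₀ y := by
  have hxΩ : x ∈ frontier Ω := hΓ ▸ Or.inl hx
  have hW : (closure Γ₁)ᶜ ∈ 𝓝 x := isClosed_closure.isOpen_compl.mem_nhds fun hx1 =>
    disjoint_left.1 (disjoint_iff_inter_eq_empty.2 hd) (subset_closure hx) hx1
  obtain ⟨N, hN, C, hC, hb⟩ := exists_local_boundary_poincare hΩ hC1 hxΩ hW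
  have hle : (surfaceMeasure Ω).restrict (closure Γ₁)ᶜ ≤ (surfaceMeasure Ω).restrict Γ₀ := by
    rw [surfaceMeasure, Measure.restrict_restrict' isClosed_frontier.measurableSet,
      Measure.restrict_restrict' isClosed_frontier.measurableSet]
    have hs : (closure Γ₁)ᶜ ∩ frontier Ω ⊆ Γ₀ ∩ frontier Ω := fun z hz =>
      ⟨(hΓ ▸ hz.2 : z ∈ Γ₀ ∪ Γ₁).resolve_right fun h => hz.1 (subset_closure h), hz.2⟩
    exact Measure.restrict_mono hs le_rfl
  filter_upwards [interior_mem_nhds.2 hN] with y hy _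
  obtain ⟨ε, hε, hεN⟩ := Metric.isOpen_iff.1 isOpen_interior y hy
  refine ⟨ε, hε, C, hC, fun φ hφ => (lintegral_mono_set ?_).trans ((hb φ hφ).trans ?_)⟩
  · gcongr
    exact hεN.trans interior_subset
  · gcongr

/-- A connectedness argument: the good points form an open set, relatively closed in `Ω` by
`PoincareAt.of_mem_ball`, and the component has some because its frontier meets `Γ₀`. -/
theorem poincareAt_of_mem (hΩ : IsOpen Ω) (hC1 : HasC1Boundary Ω)
    (hΓ : frontier Ω = Γ₀ ∪ Γ₁) (hd : closure Γ₀ ∩ closure Γ₁ = ∅)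
    {x : EuclideanSpace ℝ (Fin n)} (hx : x ∈ Ω)
    (hne : (Γ₀ ∩ frontier (connectedComponentIn Ω x)).Nonempty) : PoincareAt Ω Γ₀ x := by
  obtain ⟨x₀, hx₀, hx₀C⟩ := hne
  have hopen : IsOpen {y | y ∈ Ω ∧ PoincareAt Ω Γ₀ y} :=
    hΩ.inter (isOpen_setOf_poincareAt Ω Γ₀)
  have hstart : (connectedComponentIn Ω x ∩ {y | y ∈ Ω ∧ PoincareAt Ω Γ₀ y}).Nonempty := by
    obtain ⟨y, hy, hyC⟩ := mem_closure_iff_nhds.1 (frontier_subset_closure hx₀C) _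
      (eventually_poincareAt_of_mem_frontier hΩ hC1 hΓ hd hx₀)
    have hyΩ := connectedComponentIn_subset Ω x hyC
    exact ⟨y, hyC, hyΩ, hy hyΩ⟩
  refine (isPreconnected_connectedComponentIn.subset_of_closure_inter_subset hopen hstart ?_
    (mem_connectedComponentIn hx)).2
  rintro y ⟨hycl, hyC⟩
  have hyΩ := connectedComponentIn_subset Ω x hyC
  obtain ⟨r, hr, hrΩ⟩ := Metric.isOpen_iff.1 hΩ y hyΩ
  obtain ⟨z, hz, hzP⟩ := mem_closure_iff_nhds.1 hycl _ (Metric.ball_mem_nhds y (half_pos hr))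
  exact ⟨hyΩ, hzP.2.of_mem_ball hΩ (half_pos hr) (by rwa [mul_div_cancel₀ r two_ne_zero]) hz⟩

/-- The Poincaré inequality for smooth functions, with a boundary term on `Γ₀`. -/
theorem exists_poincare_bound (hΩ : IsOpen Ω) (hb : Bornology.IsBounded Ω)
    (hC1 : HasC1Boundary Ω) (hΓ : frontier Ω = Γ₀ ∪ Γ₁) (hd : closure Γ₀ ∩ closure Γ₁ = ∅)
    (hne : ∀ x ∈ Ω, (Γ₀ ∩ frontier (connectedComponentIn Ω x)).Nonempty) :
    ∃ C : ℝ≥0∞, C ≠ ⊤ ∧ ∀ φ : EuclideanSpace ℝ (Fin n) → ℝ, ContDiff ℝ 1 φ →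
      ∫⁻ z in Ω, ‖φ z‖ₑ ^ 2 ≤
        C * ((∫⁻ z in Ω, ‖fderiv ℝ φ z‖ₑ ^ 2) + ∫⁻ z in Γ₀, ‖φ z‖ₑ ^ 2 ∂surfaceMeasure Ω) := by
  have hin : ∀ x ∈ Ω, PoincareAt Ω Γ₀ x := fun x hx =>
    poincareAt_of_mem hΩ hC1 hΓ hd hx (hne x hx)
  have hcl : ∀ x ∈ closure Ω, PoincareAt Ω Γ₀ x := fun x hx => by
    by_cases hxΩ : x ∈ Ω
    · exact hin x hxΩ
    · exact PoincareAt.of_mem_frontier hΩ hC1 hin (hΩ.frontier_eq ▸ ⟨hx, hxΩ⟩)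
  -- Compactness requires `closure Ω`, hence local bounds at boundary points too; the measure
  -- restricted to `Ω` ignores the added points.
  obtain ⟨C, hC, h⟩ := hb.isCompact_closure.exists_setLIntegral_le (μ := volume.restrict Ω)
    (fun (φ : {φ : EuclideanSpace ℝ (Fin n) → ℝ // ContDiff ℝ 1 φ}) z => ‖φ.1 z‖ₑ ^ 2)
    (fun φ => (∫⁻ z in Ω, ‖fderiv ℝ φ.1 z‖ₑ ^ 2) + ∫⁻ z in Γ₀, ‖φ.1 z‖ₑ ^ 2 ∂surfaceMeasure Ω)
    (fun x hx => by
      obtain ⟨ε, hε, C, hC, h⟩ := hcl x hx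
      refine ⟨_, Metric.ball_mem_nhds x hε, C, hC, fun φ => ?_⟩
      rw [Measure.restrict_restrict Metric.isOpen_ball.measurableSet]
      exact h φ.1 φ.2)
  refine ⟨C, hC, fun φ hφ => le_trans ?_ (h ⟨φ, hφ⟩)⟩
  rw [Measure.restrict_restrict isClosed_closure.measurableSet,
    inter_eq_right.2 subset_closure]

/-- The trace inequality for smooth functions. -/
theorem exists_trace_bound (hΩ : IsOpen Ω) (hb : Bornology.IsBounded Ω)
    (hC1 : HasC1Boundary Ω) :
    ∃ C : ℝ≥0∞, C ≠ ⊤ ∧ ∀ φ : EuclideanSpace ℝ (Fin n) → ℝ, ContDiff ℝ 1 φ →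
      ∫⁻ z, ‖φ z‖ₑ ^ 2 ∂surfaceMeasure Ω ≤
        C * ((∫⁻ z in Ω, ‖φ z‖ₑ ^ 2) + ∫⁻ z in Ω, ‖fderiv ℝ φ z‖ₑ ^ 2) := by
  have hK : IsCompact (frontier Ω) :=
    hb.isCompact_closure.of_isClosed_subset isClosed_frontier frontier_subset_closure
  obtain ⟨C, hC, h⟩ := hK.exists_setLIntegral_le (μ := surfaceMeasure Ω)
    (fun (φ : {φ : EuclideanSpace ℝ (Fin n) → ℝ // ContDiff ℝ 1 φ}) z => ‖φ.1 z‖ₑ ^ 2)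
    (fun φ => (∫⁻ z in Ω, ‖φ.1 z‖ₑ ^ 2) + ∫⁻ z in Ω, ‖fderiv ℝ φ.1 z‖ₑ ^ 2)
    (fun x hx => by
      obtain ⟨N, hN, C, hC, h⟩ := exists_local_trace_bound hΩ hC1 hx
      exact ⟨N, hN, C, hC, fun φ => h φ.1 φ.2⟩)
  refine ⟨C, hC, fun φ hφ => le_trans ?_ (h ⟨φ, hφ⟩)⟩
  rw [surfaceMeasure, Measure.restrict_restrict isClosed_frontier.measurableSet, inter_self]

end

/-! ### Passage to `H¹_{Γ₀}(Ω)` and finiteness of `S₁ + S₂`. -/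

section

theorem eLpNorm_two_sq {α F : Type*} [MeasurableSpace α] [NormedAddCommGroup F] (f : α → F)
    (μ : Measure α) : eLpNorm f 2 μ ^ 2 = ∫⁻ x, ‖f x‖ₑ ^ 2 ∂μ := by
  have := eLpNorm_nnreal_pow_eq_lintegral (f := f) (μ := μ) (p := 2) two_ne_zero
  norm_num at this
  exact_mod_cast this

theorem tendsto_eLpNorm_of_sub {α F : Type*} [MeasurableSpace α] [NormedAddCommGroup F]
    {μ : Measure α} {f : ℕ → α → F} {g : α → F} {q : ℝ≥0∞} (hq : 1 ≤ q)
    (hf : ∀ k, AEStronglyMeasurable (f k) μ) (hg : MemLp g q μ)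
    (h : Tendsto (fun k => eLpNorm (fun x => f k x - g x) q μ) atTop (𝓝 0)) :
    Tendsto (fun k => eLpNorm (f k) q μ) atTop (𝓝 (eLpNorm g q μ)) := by
  have h1 : Tendsto (fun k => eLpNorm g q μ - eLpNorm (fun x => f k x - g x) q μ) atTop
      (𝓝 (eLpNorm g q μ)) := by
    simpa using ENNReal.Tendsto.sub tendsto_const_nhds h (Or.inl hg.2.ne)
  have h2 : Tendsto (fun k => eLpNorm g q μ + eLpNorm (fun x => f k x - g x) q μ) atTop
      (𝓝 (eLpNorm g q μ)) := by
    simpa using (tendsto_const_nhds (x := eLpNorm g q μ)).add h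
  refine tendsto_of_tendsto_of_tendsto_of_le_of_le h1 h2 (fun k => ?_) (fun k => ?_)
  · refine tsub_le_iff_right.2 ?_
    calc eLpNorm g q μ = eLpNorm (f k - (f k - g)) q μ := by rw [sub_sub_cancel]
      _ ≤ eLpNorm (f k) q μ + eLpNorm (f k - g) q μ := eLpNorm_sub_le (hf k) ((hf k).sub hg.1) hq
  · calc eLpNorm (f k) q μ = eLpNorm (g + (f k - g)) q μ := by rw [add_sub_cancel]
      _ ≤ eLpNorm g q μ + eLpNorm (f k - g) q μ := eLpNorm_add_le hg.1 ((hf k).sub hg.1) hq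

theorem enorm_gradient {E : Type*} [NormedAddCommGroup E] [InnerProductSpace ℝ E]
    [CompleteSpace E] (φ : E → ℝ) (x : E) : ‖gradient φ x‖ₑ = ‖fderiv ℝ φ x‖ₑ := by
  rw [← ofReal_norm, ← ofReal_norm, gradient, LinearIsometryEquiv.norm_map]

theorem continuous_gradient {E : Type*} [NormedAddCommGroup E] [InnerProductSpace ℝ E]
    [CompleteSpace E] {φ : E → ℝ} (hφ : ContDiff ℝ 1 φ) : Continuous (gradient φ) :=
  (InnerProductSpace.toDual ℝ E).symm.continuous.comp (hφ.continuous_fderiv one_ne_zero)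

theorem ofReal_norm_sq_Lp {α F : Type*} [MeasurableSpace α] [NormedAddCommGroup F]
    {μ : Measure α} (f : Lp F 2 μ) : ENNReal.ofReal (‖f‖ ^ 2) = eLpNorm f 2 μ ^ 2 := by
  rw [ENNReal.ofReal_pow (norm_nonneg _), Lp.norm_def, ENNReal.ofReal_toReal (Lp.eLpNorm_ne_top f)]

variable {n : ℕ} {Ω Γ₀ Γ₁ : Set (EuclideanSpace ℝ (Fin n))}

/-- The approximating `φ k` need not vanish on `Γ₀`, but they converge there to a trace that does,
so the boundary term disappears in the limit. -/
theorem exists_sq_norm_le (hΩ : IsOpen Ω) (hb : Bornology.IsBounded Ω)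
    (hC1 : HasC1Boundary Ω) (hΓ : frontier Ω = Γ₀ ∪ Γ₁) (hd : closure Γ₀ ∩ closure Γ₁ = ∅)
    (hne : ∀ x ∈ Ω, (Γ₀ ∩ frontier (connectedComponentIn Ω x)).Nonempty) :
    ∃ C : ℝ≥0∞, C ≠ ⊤ ∧ ∀ w ∈ H1Gamma Ω Γ₀,
      ENNReal.ofReal (‖w‖ ^ 2) ≤ C * ENNReal.ofReal (‖weakGradient Ω w‖ ^ 2) := by
  obtain ⟨C, hC, h⟩ := exists_poincare_bound hΩ hb hC1 hΓ hd hne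
  -- Measurability of `Γ₀` follows from the separation of the closures.
  have hmeas : MeasurableSet Γ₀ := by
    have : Γ₀ = frontier Ω ∩ (closure Γ₁)ᶜ := by
      rw [hΓ]
      ext z
      refine ⟨fun hz => ⟨Or.inl hz, fun hz1 =>
        disjoint_left.1 (disjoint_iff_inter_eq_empty.2 hd) (subset_closure hz) hz1⟩, ?_⟩
      rintro ⟨hz | hz, hz1⟩
      exacts [hz, (hz1 (subset_closure hz)).elim]
    rw [this]
    exact isClosed_frontier.measurableSet.inter isClosed_closure.measurableSet.compl
  refine ⟨C, hC, fun w hw => ?_⟩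
  obtain ⟨-, g, ⟨φ, hφ, hφw, hφG, hφg⟩, hg0⟩ := hw
  have hφ1 (k : ℕ) : ContDiff ℝ 1 (φ k) := (hφ k).of_le (by simp)
  have h1 := ENNReal.Tendsto.pow (n := 2) (tendsto_eLpNorm_of_sub one_le_two
    (fun k => (hφ1 k).continuous.aestronglyMeasurable) (Lp.memLp w) hφw)
  have h2 := ENNReal.Tendsto.pow (n := 2) (tendsto_eLpNorm_of_sub one_le_two
    (fun k => (continuous_gradient (hφ1 k)).aestronglyMeasurable)
    (Lp.memLp (weakGradient Ω w)) hφG)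
  have h3 := ENNReal.Tendsto.pow (n := 2) hφg
  rw [ofReal_norm_sq_Lp, ofReal_norm_sq_Lp]
  have h4 := ENNReal.Tendsto.const_mul (a := C) (h2.add h3) (Or.inr hC)
  rw [zero_pow two_ne_zero, add_zero] at h4
  refine le_of_tendsto_of_tendsto' h1 h4 fun k => ?_
  rw [eLpNorm_two_sq, eLpNorm_two_sq, eLpNorm_two_sq]
  simp only [enorm_gradient]
  refine (h _ (hφ1 k)).trans (mul_le_mul' le_rfl (add_le_add le_rfl ?_))
  calc ∫⁻ z in Γ₀, ‖φ k z‖ₑ ^ 2 ∂surfaceMeasure Ω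
      = ∫⁻ z in Γ₀, ‖φ k z - g z‖ₑ ^ 2 ∂surfaceMeasure Ω := by
        refine lintegral_congr_ae ?_
        filter_upwards [(ae_restrict_iff' hmeas).2 hg0] with z hz
        rw [hz, sub_zero]
    _ ≤ _ := setLIntegral_le_lintegral _ _

/-- The limit argument applies to every `g` with `IsTrace Ω w g`, so it covers the one selected by
`trace` without uniqueness of traces. -/
theorem exists_boundaryNormSq_le (hΩ : IsOpen Ω) (hb : Bornology.IsBounded Ω)
    (hC1 : HasC1Boundary Ω) :
    ∃ C : ℝ≥0∞, C ≠ ⊤ ∧ ∀ w ∈ H1Gamma Ω Γ₀, ENNReal.ofReal (boundaryNormSq Ω Γ₁ w) ≤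
      C * (ENNReal.ofReal (‖w‖ ^ 2) + ENNReal.ofReal (‖weakGradient Ω w‖ ^ 2)) := by
  obtain ⟨C, hC, h⟩ := exists_trace_bound hΩ hb hC1
  refine ⟨C, hC, fun w hw => ?_⟩
  have hex : ∃ g : L2Boundary Ω, IsTrace Ω w g := ⟨hw.2.choose, hw.2.choose_spec.1⟩
  have htr : IsTrace Ω w (trace Ω w) := by
    rw [trace, dif_pos hex]
    exact hex.choose_spec
  obtain ⟨φ, hφ, hφw, hφG, hφg⟩ := htr
  have hφ1 (k : ℕ) : ContDiff ℝ 1 (φ k) := (hφ k).of_le (by simp)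
  have h1 := ENNReal.Tendsto.pow (n := 2) (tendsto_eLpNorm_of_sub one_le_two
    (fun k => (hφ1 k).continuous.aestronglyMeasurable) (Lp.memLp w) hφw)
  have h2 := ENNReal.Tendsto.pow (n := 2) (tendsto_eLpNorm_of_sub one_le_two
    (fun k => (continuous_gradient (hφ1 k)).aestronglyMeasurable)
    (Lp.memLp (weakGradient Ω w)) hφG)
  have h3 := ENNReal.Tendsto.pow (n := 2) (tendsto_eLpNorm_of_sub one_le_two
    (fun k => (hφ1 k).continuous.aestronglyMeasurable) (Lp.memLp (trace Ω w)) hφg)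
  rw [ofReal_norm_sq_Lp, ofReal_norm_sq_Lp]
  have h4 : eLpNorm (trace Ω w) 2 (surfaceMeasure Ω) ^ 2 ≤
      C * (eLpNorm w 2 (volume.restrict Ω) ^ 2 +
        eLpNorm (weakGradient Ω w) 2 (volume.restrict Ω) ^ 2) := by
    refine le_of_tendsto_of_tendsto' h3
      (ENNReal.Tendsto.const_mul (a := C) (h1.add h2) (Or.inr hC)) fun k => ?_
    rw [eLpNorm_two_sq, eLpNorm_two_sq, eLpNorm_two_sq]
    simp only [enorm_gradient]
    exact h _ (hφ1 k)
  refine le_trans ?_ h4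
  rw [boundaryNormSq, eLpNorm_two_sq, integral_eq_lintegral_of_nonneg_ae
    (Eventually.of_forall fun _ => sq_nonneg _)
    ((Lp.stronglyMeasurable _).measurable.pow_const 2).aestronglyMeasurable]
  refine ENNReal.ofReal_toReal_le.trans (le_trans (le_of_eq ?_) (setLIntegral_le_lintegral Γ₁ _))
  refine lintegral_congr fun x => ?_
  rw [← ofReal_norm, ← ENNReal.ofReal_pow (norm_nonneg _), Real.norm_eq_abs, sq_abs]

/-- The embedding constants `S₁` and `S₂` are finite. -/
theorem S1_add_S2_ne_top (hΩ : IsOpen Ω) (hb : Bornology.IsBounded Ω)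
    (hC1 : HasC1Boundary Ω) (hΓ : frontier Ω = Γ₀ ∪ Γ₁) (hd : closure Γ₀ ∩ closure Γ₁ = ∅)
    (hne : ∀ x ∈ Ω, (Γ₀ ∩ frontier (connectedComponentIn Ω x)).Nonempty) :
    S1 Ω Γ₀ Γ₁ + S2 Ω Γ₀ ≠ ⊤ := by
  obtain ⟨C, hC, h⟩ := exists_sq_norm_le hΩ hb hC1 hΓ hd hne
  obtain ⟨C', hC', h'⟩ := exists_boundaryNormSq_le (Γ₀ := Γ₀) (Γ₁ := Γ₁) hΩ hb hC1
  have h1 : S1 Ω Γ₀ Γ₁ ≤ C' * (C + 1) := by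
    -- The product form also covers `∇w = 0`: the numerator is then `0`, and `0 / 0 = 0` in `ℝ≥0∞`.
    refine iSup₂_le fun w hw => ENNReal.div_le_of_le_mul ((h' w hw.1).trans ?_)
    rw [mul_assoc, add_mul, one_mul]
    gcongr
    exact h w hw.1
  have h2 : S2 Ω Γ₀ ≤ C := iSup₂_le fun w hw => ENNReal.div_le_of_le_mul (h w hw.1)
  exact ENNReal.add_ne_top.2
    ⟨(h1.trans_lt (by finiteness)).ne, (h2.trans_lt hC.lt_top).ne⟩

end

/-! ### Test functions as elements of `H¹_{Γ₀}(Ω)`. -/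

section

variable {n : ℕ} {Ω Γ₀ : Set (EuclideanSpace ℝ (Fin n))}
  {φ ψ : EuclideanSpace ℝ (Fin n) → ℝ}

/-- `φ` is a smooth function with compact support in `Ω`. -/
structure IsTestFunction (Ω : Set (EuclideanSpace ℝ (Fin n)))
    (φ : EuclideanSpace ℝ (Fin n) → ℝ) : Prop where
  contDiff : ContDiff ℝ ∞ φ
  hasCompactSupport : HasCompactSupport φ
  tsupport_subset : tsupport φ ⊆ Ω

namespace IsTestFunction

theorem add (hφ : IsTestFunction Ω φ) (hψ : IsTestFunction Ω ψ) : IsTestFunction Ω (φ + ψ) :=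
  ⟨hφ.contDiff.add hψ.contDiff, hφ.hasCompactSupport.add hψ.hasCompactSupport,
    (tsupport_add φ ψ).trans (union_subset hφ.tsupport_subset hψ.tsupport_subset)⟩

theorem mul_left {f : EuclideanSpace ℝ (Fin n) → ℝ} (hf : ContDiff ℝ ∞ f)
    (hφ : IsTestFunction Ω φ) : IsTestFunction Ω (f * φ) :=
  ⟨hf.mul hφ.contDiff, hφ.hasCompactSupport.mul_left,
    (tsupport_mul_subset_right).trans hφ.tsupport_subset⟩

theorem const_smul (c : ℝ) (hφ : IsTestFunction Ω φ) : IsTestFunction Ω (c • φ) := by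
  have h := mul_left (f := fun _ => c) contDiff_const hφ
  exact h

theorem contDiff_one (hφ : IsTestFunction Ω φ) : ContDiff ℝ 1 φ := hφ.contDiff.of_le (by simp)

theorem continuous (hφ : IsTestFunction Ω φ) : Continuous φ := hφ.contDiff.continuous

theorem differentiable (hφ : IsTestFunction Ω φ) : Differentiable ℝ φ :=
  hφ.contDiff_one.differentiable one_ne_zero

theorem memLp (hφ : IsTestFunction Ω φ) : MemLp φ 2 (volume.restrict Ω) :=
  hφ.continuous.memLp_of_hasCompactSupport hφ.hasCompactSupport

theorem memLp_gradient (hφ : IsTestFunction Ω φ) : MemLp (gradient φ) 2 (volume.restrict Ω) :=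
  (continuous_gradient hφ.contDiff_one).memLp_of_hasCompactSupport
    ((hφ.hasCompactSupport.fderiv ℝ).comp_left (map_zero _))

/-- The class of a test function in `L²(Ω)`. -/
noncomputable def toL2 (hφ : IsTestFunction Ω φ) : L2 Ω := hφ.memLp.toLp φ

/-- The class of the gradient of a test function in `L²(Ω; ℝⁿ)`. -/
noncomputable def gradL2 (hφ : IsTestFunction Ω φ) : L2Vec Ω := hφ.memLp_gradient.toLp (gradient φ)

theorem gradient_add (hφ : IsTestFunction Ω φ) (hψ : IsTestFunction Ω ψ) :
    gradient (φ + ψ) = gradient φ + gradient ψ := by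
  ext1 x
  simp only [gradient, Pi.add_apply]
  rw [fderiv_add (hφ.differentiable x) (hψ.differentiable x), map_add]

theorem gradient_const_smul (c : ℝ) (hφ : IsTestFunction Ω φ) :
    gradient (c • φ) = c • gradient φ := by
  ext1 x
  simp only [gradient, Pi.smul_apply]
  rw [fderiv_const_smul (hφ.differentiable x), map_smul]

theorem toL2_add (hφ : IsTestFunction Ω φ) (hψ : IsTestFunction Ω ψ) :
    (hφ.add hψ).toL2 = hφ.toL2 + hψ.toL2 :=
  MemLp.toLp_add hφ.memLp hψ.memLp

theorem toL2_const_smul (c : ℝ) (hφ : IsTestFunction Ω φ) :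
    (hφ.const_smul c).toL2 = c • hφ.toL2 :=
  MemLp.toLp_const_smul c hφ.memLp

theorem gradL2_add (hφ : IsTestFunction Ω φ) (hψ : IsTestFunction Ω ψ) :
    (hφ.add hψ).gradL2 = hφ.gradL2 + hψ.gradL2 := by
  simp only [gradL2, gradient_add hφ hψ]
  exact MemLp.toLp_add hφ.memLp_gradient hψ.memLp_gradient

theorem gradL2_const_smul (c : ℝ) (hφ : IsTestFunction Ω φ) :
    (hφ.const_smul c).gradL2 = c • hφ.gradL2 := by
  simp only [gradL2, gradient_const_smul c hφ]
  exact MemLp.toLp_const_smul c hφ.memLp_gradient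

theorem ofReal_norm_toL2_sq (hφ : IsTestFunction Ω φ) :
    ENNReal.ofReal (‖hφ.toL2‖ ^ 2) = ∫⁻ x in Ω, ‖φ x‖ₑ ^ 2 := by
  rw [ofReal_norm_sq_Lp, ← eLpNorm_two_sq, toL2, eLpNorm_congr_ae hφ.memLp.coeFn_toLp]

theorem ofReal_norm_gradL2_sq (hφ : IsTestFunction Ω φ) :
    ENNReal.ofReal (‖hφ.gradL2‖ ^ 2) = ∫⁻ x in Ω, ‖fderiv ℝ φ x‖ₑ ^ 2 := by
  simp only [← enorm_gradient]
  rw [ofReal_norm_sq_Lp, ← eLpNorm_two_sq, gradL2, eLpNorm_congr_ae hφ.memLp_gradient.coeFn_toLp]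

theorem gradient_apply (φ : EuclideanSpace ℝ (Fin n) → ℝ) (x : EuclideanSpace ℝ (Fin n))
    (i : Fin n) : gradient φ x i = fderiv ℝ φ x (EuclideanSpace.single i 1) := by
  have h : inner ℝ (gradient φ x) (EuclideanSpace.single i (1 : ℝ)) =
      fderiv ℝ φ x (EuclideanSpace.single i 1) := by
    rw [gradient, InnerProductSpace.toDual_symm_apply]
  rw [← h, EuclideanSpace.inner_single_right]
  simp

theorem setIntegral_eq {F : EuclideanSpace ℝ (Fin n) → ℝ}
    (h : ∀ x ∉ Ω, F x = 0) : ∫ x in Ω, F x = ∫ x, F x :=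
  setIntegral_eq_integral_of_forall_compl_eq_zero h

theorem fderiv_eq_zero (hφ : IsTestFunction Ω φ) {x : EuclideanSpace ℝ (Fin n)} (hx : x ∉ Ω) :
    fderiv ℝ φ x = 0 :=
  image_eq_zero_of_notMem_tsupport fun h =>
    hx (hφ.tsupport_subset (tsupport_fderiv_subset ℝ h))

/-- Extended by zero, all integrands live on the whole space, where integration by parts has no
boundary term. -/
theorem isWeakGradient (hφ : IsTestFunction Ω φ) : IsWeakGradient Ω hφ.toL2 hφ.gradL2 := by
  intro ψ hψ hψc hψΩ i
  have hψ1 : ContDiff ℝ 1 ψ := hψ.of_le (by simp)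
  have h1 : ∫ x in Ω, hφ.toL2 x * fderiv ℝ ψ x (EuclideanSpace.single i 1) =
      ∫ x, φ x * fderiv ℝ ψ x (EuclideanSpace.single i 1) := by
    rw [← setIntegral_eq (Ω := Ω) fun x hx => by
      rw [image_eq_zero_of_notMem_tsupport fun h => hx (hφ.tsupport_subset h), zero_mul]]
    refine integral_congr_ae ?_
    filter_upwards [hφ.memLp.coeFn_toLp] with x hx
    rw [toL2, hx]
  have h2 : ∫ x in Ω, hφ.gradL2 x i * ψ x =
      ∫ x, fderiv ℝ φ x (EuclideanSpace.single i 1) * ψ x := by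
    rw [← setIntegral_eq (Ω := Ω) fun x hx => by rw [hφ.fderiv_eq_zero hx]; simp]
    refine integral_congr_ae ?_
    filter_upwards [hφ.memLp_gradient.coeFn_toLp] with x hx
    rw [gradL2, hx, gradient_apply]
  have hd (f : EuclideanSpace ℝ (Fin n) → ℝ) (hf : ContDiff ℝ 1 f) :
      Continuous fun x => fderiv ℝ f x (EuclideanSpace.single i 1) :=
    (hf.continuous_fderiv one_ne_zero).clm_apply continuous_const
  rw [h1, h2]
  refine integral_mul_fderiv_eq_neg_fderiv_mul_of_integrable ?_ ?_ ?_
    (fun x _ => hφ.differentiable x) (fun x _ => hψ1.differentiable one_ne_zero x)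
  · exact ((hd φ hφ.contDiff_one).mul hψ1.continuous).integrable_of_hasCompactSupport
      hψc.mul_left
  · exact (hφ.continuous.mul (hd ψ hψ1)).integrable_of_hasCompactSupport
      hφ.hasCompactSupport.mul_right
  · exact (hφ.continuous.mul hψ1.continuous).integrable_of_hasCompactSupport hψc.mul_left

end IsTestFunction

theorem _root_.EuclideanSpace.memLp_coord {α : Type*} [MeasurableSpace α] {μ : Measure α}
    {q : ℝ≥0∞} {G : α → EuclideanSpace ℝ (Fin n)} (hG : MemLp G q μ) (i : Fin n) :
    MemLp (fun x => G x i) q μ :=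
  hG.of_le ((EuclideanSpace.proj (𝕜 := ℝ) i).continuous.comp_aestronglyMeasurable hG.1)
    (Eventually.of_forall fun x => PiLp.norm_apply_le (G x) i)

/-- Weak gradients are unique. -/
theorem IsWeakGradient.eq (hΩ : IsOpen Ω) {w : L2 Ω} {G G' : L2Vec Ω}
    (h : IsWeakGradient Ω w G) (h' : IsWeakGradient Ω w G') : G = G' := by
  have hcoord (i : Fin n) : ∀ᵐ x ∂volume.restrict Ω, G x i - G' x i = 0 := by
    have hL2 := (EuclideanSpace.memLp_coord (Lp.memLp G) i).sub
      (EuclideanSpace.memLp_coord (Lp.memLp G') i)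
    have hloc : LocallyIntegrable (fun x => G x i - G' x i) (volume.restrict Ω) :=
      hL2.locallyIntegrable one_le_two
    rw [ae_restrict_iff' hΩ.measurableSet]
    -- The fundamental lemma of the calculus of variations, applied to each coordinate of `G - G'`.
    refine hΩ.ae_eq_zero_of_integral_contDiff_smul_eq_zero ?_ ?_
    · intro x hx
      obtain ⟨U, hU, hint⟩ := hloc x
      refine ⟨U ∩ Ω, inter_mem (mem_nhdsWithin_of_mem_nhds hU) self_mem_nhdsWithin, ?_⟩
      rw [IntegrableOn, Measure.restrict_restrict_of_subset inter_subset_right |>.symm]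
      exact hint.mono_set inter_subset_left
    · intro ψ hψ hψc hψΩ
      have hψL : MemLp ψ 2 (volume.restrict Ω) :=
        hψ.continuous.memLp_of_hasCompactSupport hψc
      have h1 := h ψ hψ hψc hψΩ i
      rw [h' ψ hψ hψc hψΩ i, neg_inj] at h1
      rw [← IsTestFunction.setIntegral_eq (Ω := Ω) fun x hx => by
        rw [image_eq_zero_of_notMem_tsupport fun h => hx (hψΩ h), zero_smul]]
      have hi1 : Integrable (fun x => G x i * ψ x) (volume.restrict Ω) :=
        (EuclideanSpace.memLp_coord (Lp.memLp G) i).integrable_mul hψL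
      have hi2 : Integrable (fun x => G' x i * ψ x) (volume.restrict Ω) :=
        (EuclideanSpace.memLp_coord (Lp.memLp G') i).integrable_mul hψL
      calc ∫ x in Ω, ψ x • (G x i - G' x i) = ∫ x in Ω, (G x i * ψ x - G' x i * ψ x) := by
            congr 1
            ext x
            rw [smul_eq_mul]
            ring
        _ = 0 := by rw [integral_sub hi1 hi2, h1, sub_self]
  refine Lp.ext ?_
  filter_upwards [ae_all_iff.2 hcoord] with x hx
  ext i
  exact sub_eq_zero.1 (hx i)

namespace IsTestFunction

/-- `weakGradient` is a choice, so uniqueness is what identifies it with the classical gradient. -/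
theorem weakGradient_toL2 (hΩ : IsOpen Ω) (hφ : IsTestFunction Ω φ) :
    weakGradient Ω hφ.toL2 = hφ.gradL2 := by
  have hex : ∃ G : L2Vec Ω, IsWeakGradient Ω hφ.toL2 G := ⟨_, hφ.isWeakGradient⟩
  rw [weakGradient, dif_pos hex]
  exact hex.choose_spec.eq hΩ hφ.isWeakGradient

/-- The constant sequence `φ` shows that the trace is `0`: the support lies in the open set `Ω`,
which is disjoint from its frontier. -/
theorem toL2_mem_H1Gamma (hΩ : IsOpen Ω) (hφ : IsTestFunction Ω φ) (Γ₀ : Set _) :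
    hφ.toL2 ∈ H1Gamma Ω Γ₀ := by
  refine ⟨⟨_, hφ.isWeakGradient⟩, 0, ⟨fun _ => φ, fun _ => hφ.contDiff, ?_, ?_, ?_⟩, ?_⟩
  · have h : (fun x => φ x - hφ.toL2 x) =ᵐ[volume.restrict Ω] 0 := by
      filter_upwards [hφ.memLp.coeFn_toLp] with x hx
      simp [toL2, hx]
    beta_reduce
    rw [eLpNorm_congr_ae h, eLpNorm_zero]
    exact tendsto_const_nhds
  · have h : (fun x => gradient φ x - weakGradient Ω hφ.toL2 x) =ᵐ[volume.restrict Ω] 0 := by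
      rw [hφ.weakGradient_toL2 hΩ]
      filter_upwards [hφ.memLp_gradient.coeFn_toLp] with x hx
      simp [gradL2, hx]
    beta_reduce
    rw [eLpNorm_congr_ae h, eLpNorm_zero]
    exact tendsto_const_nhds
  · have h : (fun x => φ x - (0 : L2Boundary Ω) x) =ᵐ[surfaceMeasure Ω] 0 := by
      filter_upwards [Lp.coeFn_zero ℝ 2 (surfaceMeasure Ω),
        ae_restrict_mem isClosed_frontier.measurableSet] with x hx hxf
      have hxΩ : x ∉ Ω := fun h => (hΩ.inter_frontier_eq ▸ ⟨h, hxf⟩ : x ∈ (∅ : Set _))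
      have h0 : φ x = 0 :=
        image_eq_zero_of_notMem_tsupport fun hxs => hxΩ (hφ.tsupport_subset hxs)
      rw [h0, hx]
      exact sub_zero 0
    beta_reduce
    rw [eLpNorm_congr_ae h, eLpNorm_zero]
    exact tendsto_const_nhds
  · filter_upwards [Lp.coeFn_zero ℝ 2 (surfaceMeasure Ω)] with x hx _
    rw [hx, Pi.zero_apply]

theorem J_toL2 (hΩ : IsOpen Ω) (hφ : IsTestFunction Ω φ) (p : ℝ) :
    J Ω p hφ.toL2 = 1 / 2 * ‖hφ.gradL2‖ ^ 2 - 1 / p * ∫ x in Ω, |φ x| ^ p := by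
  rw [J, hφ.weakGradient_toL2 hΩ]
  congr 2
  refine integral_congr_ae ?_
  filter_upwards [hφ.memLp.coeFn_toLp] with x hx
  rw [toL2, hx]

theorem integrable_abs_rpow (hφ : IsTestFunction Ω φ) {p : ℝ} (hp : 0 < p) :
    Integrable (fun x => |φ x| ^ p) (volume.restrict Ω) :=
  ((hφ.continuous.abs).rpow_const fun _ => Or.inr hp.le).integrable_of_hasCompactSupport
    (hφ.hasCompactSupport.comp_left (g := fun y : ℝ => |y| ^ p)
      (by simp [Real.zero_rpow hp.ne']))

theorem integral_abs_rpow_pos (hφ : IsTestFunction Ω φ) {p : ℝ} (hp : 0 < p)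
    (h : hφ.toL2 ≠ 0) : 0 < ∫ x in Ω, |φ x| ^ p := by
  refine lt_of_le_of_ne (integral_nonneg fun x => by positivity) fun h0 => h ?_
  have h1 := (integral_eq_zero_iff_of_nonneg (fun x => by positivity)
    (hφ.integrable_abs_rpow hp)).1 h0.symm
  refine (MemLp.toLp_eq_toLp_iff hφ.memLp MemLp.zero).2 ?_ |>.trans (MemLp.toLp_zero _)
  filter_upwards [h1] with x hx
  simpa using (Real.rpow_eq_zero (abs_nonneg _) hp.ne').1 hx

end IsTestFunction

end

/-! ### Test functions of large norm and energy, and the energy along rays. -/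

section

variable {n : ℕ} {Ω Γ₀ Γ₁ : Set (EuclideanSpace ℝ (Fin n))}
  {χ : EuclideanSpace ℝ (Fin n) → ℝ}

theorem exists_isTestFunction_ne_zero (hΩ : IsOpen Ω) (hne : Ω.Nonempty) :
    ∃ (φ : EuclideanSpace ℝ (Fin n) → ℝ) (hφ : IsTestFunction Ω φ), hφ.toL2 ≠ 0 := by
  obtain ⟨x, hx⟩ := hne
  obtain ⟨f, hf, hfc, hfd, -, hfx⟩ := exists_contDiff_tsupport_subset (n := ⊤) (hΩ.mem_nhds hx)
  have ht : IsTestFunction Ω f := ⟨hfd, hfc, hf⟩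
  refine ⟨f, ht, fun h0 => ?_⟩
  have h1 : ∫⁻ z in Ω, ‖f z‖ₑ ^ 2 = 0 := by
    rw [← ht.ofReal_norm_toL2_sq, h0]
    simp
  rw [setLIntegral_eq_zero_iff hΩ.measurableSet
    (ht.continuous.enorm.measurable.pow_const 2)] at h1
  have hU : IsOpen {z | z ∈ Ω ∧ f z ≠ 0} :=
    hΩ.inter (isOpen_ne_fun ht.continuous continuous_const)
  refine (hU.measure_pos volume ⟨x, hx, by rw [hfx]; exact one_ne_zero⟩).ne' ?_
  refine measure_mono_null (t := {z | ¬(z ∈ Ω → ‖f z‖ₑ ^ 2 = 0)}) (fun z hz hz' => hz.2 ?_)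
    (ae_iff.1 h1)
  simpa using hz' hz.1

/-- Modulating a test function by a sine or cosine of high frequency makes its gradient large. -/
theorem IsTestFunction.exists_oscillation (hn : 1 ≤ n) (hχ : IsTestFunction Ω χ) (k : ℝ) :
    ∃ (η : EuclideanSpace ℝ (Fin n) → ℝ) (hη : IsTestFunction Ω η), (∀ x, |η x| ≤ |χ x|) ∧
      k ^ 2 * ‖hχ.toL2‖ ^ 2 ≤ 2 * ‖hη.gradL2‖ ^ 2 := by
  let u : EuclideanSpace ℝ (Fin n) := EuclideanSpace.single ⟨0, hn⟩ 1
  have hu : ‖u‖ = 1 := by simp [u]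
  have hlin (x : EuclideanSpace ℝ (Fin n)) :
      HasFDerivAt (fun x => k * inner ℝ u x) (k • innerSL ℝ u) x :=
    ((innerSL ℝ u).hasFDerivAt (x := x)).const_mul k
  have hsm : ContDiff ℝ ∞ fun x : EuclideanSpace ℝ (Fin n) => k * inner ℝ u x :=
    contDiff_const.mul (innerSL ℝ u).contDiff
  have hc : IsTestFunction Ω ((fun x => Real.cos (k * inner ℝ u x)) * χ) :=
    hχ.mul_left hsm.cos
  have hs : IsTestFunction Ω ((fun x => Real.sin (k * inner ℝ u x)) * χ) :=
    hχ.mul_left hsm.sin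
  -- Along `u`, the squared derivatives of `cos · χ` and `sin · χ` add up to `(∂ᵤχ)² + k² χ²`: the
  -- cross terms cancel.
  have hpt (x : EuclideanSpace ℝ (Fin n)) : ENNReal.ofReal (k ^ 2) * ‖χ x‖ₑ ^ 2 ≤
      ‖fderiv ℝ ((fun x => Real.cos (k * inner ℝ u x)) * χ) x‖ₑ ^ 2 +
        ‖fderiv ℝ ((fun x => Real.sin (k * inner ℝ u x)) * χ) x‖ₑ ^ 2 := by
    have hdχ := (hχ.differentiable x).hasFDerivAt
    have h1 := ((hlin x).cos.mul hdχ).fderiv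
    have h2 := ((hlin x).sin.mul hdχ).fderiv
    have b1 := (fderiv ℝ ((fun x => Real.cos (k * inner ℝ u x)) * χ) x).le_opNorm u
    have b2 := (fderiv ℝ ((fun x => Real.sin (k * inner ℝ u x)) * χ) x).le_opNorm u
    have e1 : fderiv ℝ ((fun x => Real.cos (k * inner ℝ u x)) * χ) x u =
        Real.cos (k * inner ℝ u x) * fderiv ℝ χ x u - k * Real.sin (k * inner ℝ u x) * χ x := by
      rw [h1]
      simp [hu]
      ring
    have e2 : fderiv ℝ ((fun x => Real.sin (k * inner ℝ u x)) * χ) x u =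
        Real.sin (k * inner ℝ u x) * fderiv ℝ χ x u + k * Real.cos (k * inner ℝ u x) * χ x := by
      rw [h2]
      simp [hu]
      ring
    rw [hu, mul_one] at b1 b2
    simp only [← ofReal_norm, ← ENNReal.ofReal_pow (norm_nonneg _)]
    rw [← ENNReal.ofReal_mul (sq_nonneg _), ← ENNReal.ofReal_add (sq_nonneg _) (sq_nonneg _)]
    refine ENNReal.ofReal_le_ofReal ?_
    have c1 := pow_le_pow_left₀ (norm_nonneg _) b1 2
    have c2 := pow_le_pow_left₀ (norm_nonneg _) b2 2
    rw [Real.norm_eq_abs, sq_abs] at c1 c2 ⊢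
    rw [e1] at c1
    rw [e2] at c2
    refine le_trans ?_ (add_le_add c1 c2)
    have htrig := Real.sin_sq_add_cos_sq (k * inner ℝ u x)
    generalize Real.sin (k * inner ℝ u x) = s at *
    generalize Real.cos (k * inner ℝ u x) = c at *
    have : (c * fderiv ℝ χ x u - k * s * χ x) ^ 2 + (s * fderiv ℝ χ x u + k * c * χ x) ^ 2 =
        (s ^ 2 + c ^ 2) * (fderiv ℝ χ x u) ^ 2 + (s ^ 2 + c ^ 2) * (k ^ 2 * χ x ^ 2) := by ring
    rw [this, htrig]
    nlinarith [sq_nonneg (fderiv ℝ χ x u)]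
  have hsum : k ^ 2 * ‖hχ.toL2‖ ^ 2 ≤ ‖hc.gradL2‖ ^ 2 + ‖hs.gradL2‖ ^ 2 := by
    rw [← ENNReal.ofReal_le_ofReal_iff (by positivity), ENNReal.ofReal_mul (sq_nonneg _),
      ENNReal.ofReal_add (sq_nonneg _) (sq_nonneg _), hχ.ofReal_norm_toL2_sq,
      hc.ofReal_norm_gradL2_sq, hs.ofReal_norm_gradL2_sq,
      ← lintegral_const_mul' _ _ ENNReal.ofReal_ne_top,
      ← lintegral_add_left (measurable_sq_enorm_fderiv hc.contDiff_one)]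
    exact lintegral_mono hpt
  have hbd {b : ℝ} (hb : |b| ≤ 1) (y : ℝ) : |b * y| ≤ |y| := by
    rw [abs_mul]
    exact mul_le_of_le_one_left (abs_nonneg _) hb
  -- The larger of the two carries at least half of the sum, whence the factor `2`.
  rcases le_total (‖hc.gradL2‖ ^ 2) (‖hs.gradL2‖ ^ 2) with h | h
  · exact ⟨_, hs, fun x => hbd (Real.abs_sin_le_one _) _, by linarith⟩
  · exact ⟨_, hc, fun x => hbd (Real.abs_cos_le_one _) _, by linarith⟩

/-- There are test functions with arbitrarily large `L²` norm and arbitrarily large energy. -/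
theorem exists_isTestFunction_large (hn : 1 ≤ n) (hΩ : IsOpen Ω) (hne : Ω.Nonempty) {p : ℝ}
    (hp : 0 < p) (R : ℝ) :
    ∃ (ψ : EuclideanSpace ℝ (Fin n) → ℝ) (hψ : IsTestFunction Ω ψ),
      R < ‖hψ.toL2‖ ^ 2 ∧ R ≤ J Ω p hψ.toL2 := by
  obtain ⟨χ, hχ, hχR⟩ : ∃ (χ : EuclideanSpace ℝ (Fin n) → ℝ) (hχ : IsTestFunction Ω χ),
      |R| < ‖hχ.toL2‖ ^ 2 := by
    obtain ⟨φ, hφ, h0⟩ := exists_isTestFunction_ne_zero hΩ hne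
    have hpos : 0 < ‖hφ.toL2‖ := norm_pos_iff.2 h0
    refine ⟨_, hφ.const_smul ((|R| + 1) / ‖hφ.toL2‖), ?_⟩
    rw [IsTestFunction.toL2_const_smul _ hφ, norm_smul, Real.norm_of_nonneg (by positivity),
      div_mul_cancel₀ _ hpos.ne']
    nlinarith [abs_nonneg R]
  have hχ0 : 0 < ‖hχ.toL2‖ := by
    by_contra h
    have : ‖hχ.toL2‖ = 0 := le_antisymm (not_lt.1 h) (norm_nonneg _)
    rw [this] at hχR
    linarith [abs_nonneg R, zero_pow (M₀ := ℝ) two_ne_zero]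
  have hχ2 : IsTestFunction Ω ((2 : ℝ) • χ) := hχ.const_smul 2
  -- `|χ ± η| ≤ |2χ|`, so `K` bounds the `L^p` term whatever the frequency of `η`.
  set K := ∫ x in Ω, |((2 : ℝ) • χ) x| ^ p
  have hK0 : 0 ≤ K := integral_nonneg fun x => by positivity
  -- A gradient norm of at least `m` suffices: `m ≥ 1` gives `m² / 2 ≥ m / 2 ≥ |R| + K / p`.
  set m := 2 * (|R| + 1 / p * K) + 1 with hm
  have hm1 : 1 ≤ m := by
    have : 0 ≤ |R| + 1 / p * K := by positivity
    linarith
  -- This frequency gives `4 (m + ‖∇χ‖)² ≤ 2 ‖∇η‖²`, so that `‖∇(χ ± η)‖ ≥ m` by the triangle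
  -- inequality.
  obtain ⟨η, hη, hηχ, hηg⟩ :=
    hχ.exists_oscillation hn (2 * (m + ‖hχ.gradL2‖) / ‖hχ.toL2‖)
  rw [div_pow, div_mul_cancel₀ _ (by positivity)] at hηg
  have hηg' : m + ‖hχ.gradL2‖ ≤ ‖hη.gradL2‖ := by
    refine le_of_sq_le_sq ?_ (norm_nonneg _)
    nlinarith [sq_nonneg (m + ‖hχ.gradL2‖)]
  have main (s : ℝ) (hs : |s| = 1) : R ≤ J Ω p (hχ.add (hη.const_smul s)).toL2 := by
    rw [IsTestFunction.J_toL2 hΩ]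
    have hgrad : m ≤ ‖(hχ.add (hη.const_smul s)).gradL2‖ := by
      rw [IsTestFunction.gradL2_add hχ (hη.const_smul s),
        IsTestFunction.gradL2_const_smul s hη, add_comm]
      have h1 := norm_sub_norm_le (s • hη.gradL2) (-hχ.gradL2)
      rw [norm_smul, norm_neg, Real.norm_eq_abs, hs, one_mul, sub_neg_eq_add] at h1
      linarith
    have hint : ∫ x in Ω, |(χ + s • η) x| ^ p ≤ K := by
      refine integral_mono_of_nonneg (Eventually.of_forall fun x => by positivity)
        (hχ2.integrable_abs_rpow hp) (Eventually.of_forall fun x => ?_)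
      refine Real.rpow_le_rpow (abs_nonneg _) ?_ hp.le
      simp only [Pi.add_apply, Pi.smul_apply, smul_eq_mul]
      calc |χ x + s * η x| ≤ |χ x| + |s * η x| := abs_add_le _ _
        _ ≤ |χ x| + |χ x| := by rw [abs_mul, hs, one_mul]; exact add_le_add le_rfl (hηχ x)
        _ = |2 * χ x| := by rw [abs_mul, abs_two, two_mul]
    have h2 : 1 / p * ∫ x in Ω, |(χ + s • η) x| ^ p ≤ 1 / p * K := by gcongr
    have h3 := pow_le_pow_left₀ (by linarith) hgrad 2
    nlinarith [le_abs_self R]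
  -- By the parallelogram law, adding `η` with one of the two signs does not decrease the `L²` norm.
  have hpar : ‖hχ.toL2‖ ^ 2 ≤ ‖(hχ.add (hη.const_smul 1)).toL2‖ ^ 2 ∨
      ‖hχ.toL2‖ ^ 2 ≤ ‖(hχ.add (hη.const_smul (-1))).toL2‖ ^ 2 := by
    by_contra! h
    have h1 := parallelogram_law_with_norm ℝ hχ.toL2 hη.toL2
    rw [IsTestFunction.toL2_add hχ (hη.const_smul 1),
      IsTestFunction.toL2_add hχ (hη.const_smul (-1)), IsTestFunction.toL2_const_smul 1 hη,
      IsTestFunction.toL2_const_smul (-1) hη, one_smul, neg_smul, one_smul, ← sub_eq_add_neg] at h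
    nlinarith [h.1, h.2, sq_nonneg ‖hη.toL2‖]
  rcases hpar with h | h
  · exact ⟨_, _, ((le_abs_self R).trans_lt hχR).trans_le h, main 1 abs_one⟩
  · exact ⟨_, _, ((le_abs_self R).trans_lt hχR).trans_le h, main (-1) (by simp)⟩

/-- Along the ray through a test function, the energy takes every value below its initial one. -/
theorem IsTestFunction.exists_J_const_smul_eq (hΩ : IsOpen Ω) {ψ : EuclideanSpace ℝ (Fin n) → ℝ}
    (hψ : IsTestFunction Ω ψ) (h0 : hψ.toL2 ≠ 0) {p : ℝ} (hp : 2 < p) {a : ℝ}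
    (ha : a ≤ J Ω p hψ.toL2) : ∃ t : ℝ, 1 ≤ t ∧ J Ω p (hψ.const_smul t).toL2 = a := by
  have hp0 : 0 < p := by linarith
  set A := ‖hψ.gradL2‖ ^ 2
  set B := ∫ x in Ω, |ψ x| ^ p
  have hB : 0 < B := hψ.integral_abs_rpow_pos hp0 h0
  have hJ (t : ℝ) (ht : 0 ≤ t) :
      J Ω p (hψ.const_smul t).toL2 = 1 / 2 * (t ^ 2 * A) - 1 / p * (t ^ p * B) := by
    have hint : ∫ x in Ω, |(t • ψ) x| ^ p = t ^ p * B := by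
      rw [← integral_const_mul]
      refine integral_congr_ae (Eventually.of_forall fun x => ?_)
      beta_reduce
      rw [Pi.smul_apply, smul_eq_mul, abs_mul, abs_of_nonneg ht, Real.mul_rpow ht (abs_nonneg _)]
    rw [IsTestFunction.J_toL2 hΩ, IsTestFunction.gradL2_const_smul t hψ, norm_smul, mul_pow,
      Real.norm_eq_abs, sq_abs, hint]
  -- For this `T`, `T ^ p * B / p ≥ T² (A / 2 + |a|)`, so the energy at `T` is at most `-T² |a| ≤
  -- a`.
  obtain ⟨T, hT, hT1⟩ := ((tendsto_rpow_atTop (sub_pos.2 hp)).eventually_ge_atTop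
    ((A / 2 + |a|) * p / B)).and (eventually_ge_atTop 1) |>.exists
  have hT0 : 0 < T := by linarith
  have hfT : 1 / 2 * (T ^ 2 * A) - 1 / p * (T ^ p * B) ≤ a := by
    have h1 : T ^ p = T ^ 2 * T ^ (p - 2) := by
      rw [← Real.rpow_natCast, ← Real.rpow_add hT0]
      norm_num
    rw [div_le_iff₀ hB] at hT
    have h2 : A / 2 + |a| ≤ 1 / p * (T ^ (p - 2) * B) := by
      rw [one_div, inv_mul_eq_div, le_div_iff₀ hp0]
      exact hT
    have h3 : 1 ≤ T ^ 2 := one_le_pow₀ hT1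
    rw [h1]
    nlinarith [neg_abs_le a, abs_nonneg a, mul_le_mul_of_nonneg_left h2 (sq_nonneg T)]
  have hcont : ContinuousOn (fun t : ℝ => 1 / 2 * (t ^ 2 * A) - 1 / p * (t ^ p * B))
      (Icc 1 T) :=
    (Continuous.sub (by fun_prop) (continuous_const.mul
      ((Real.continuous_rpow_const hp0.le).mul continuous_const))).continuousOn
  have ha1 : a ≤ 1 / 2 * ((1 : ℝ) ^ 2 * A) - 1 / p * ((1 : ℝ) ^ p * B) := by
    rwa [one_pow, Real.one_rpow, one_mul, one_mul, ← hψ.J_toL2 hΩ]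
  obtain ⟨t, ht, hta⟩ := intermediate_value_Icc' hT1 hcont ⟨hfT, ha1⟩
  exact ⟨t, ht.1, (hJ t (by linarith [ht.1])).trans hta⟩

/-- Rules out `S₁ + S₂ = 0`, for which the quotient in `B2` would be `0` by the convention on
division. -/
theorem S2_pos (hΩ : IsOpen Ω) (hne : Ω.Nonempty) : 0 < S2 Ω Γ₀ := by
  obtain ⟨φ, hφ, h0⟩ := exists_isTestFunction_ne_zero hΩ hne
  refine lt_of_lt_of_le ?_ (le_iSup₂ (f := fun w (_ : w ∈ {w : L2 Ω | w ∈ H1Gamma Ω Γ₀ ∧ w ≠ 0}) =>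
    ENNReal.ofReal (‖w‖ ^ 2) / ENNReal.ofReal (‖weakGradient Ω w‖ ^ 2)) hφ.toL2
    ⟨hφ.toL2_mem_H1Gamma hΩ Γ₀, h0⟩)
  have : 0 < ‖hφ.toL2‖ := norm_pos_iff.2 h0
  exact ENNReal.div_pos (by simpa using h0) ENNReal.ofReal_ne_top

end

end BlowUp

/-! ### Conclusion. -/

theorem corollary3p2 (n : ℕ) (hn : 1 ≤ n)
    (Ω Γ₀ Γ₁ : Set (EuclideanSpace ℝ (Fin n)))
    (hΩ_open : IsOpen Ω) (hΩ_bdd : Bornology.IsBounded Ω) (hΩ_C1 : BlowUp.HasC1Boundary Ω)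
    (hΓ_union : frontier Ω = Γ₀ ∪ Γ₁) (hΓ_closure : closure Γ₀ ∩ closure Γ₁ = ∅)
    (hΓ₀_pos : 0 < BlowUp.surfaceMeasure Ω Γ₀)
    (hΓ₀_comp : ∀ x ∈ Ω,
      0 < BlowUp.surfaceMeasure Ω (Γ₀ ∩ frontier (connectedComponentIn Ω x)))
    (p : ℝ) (hp : 2 < p)
    (hp_crit : 3 ≤ n → p ≤ 1 + (2 * (n : ℝ) / ((n : ℝ) - 2)) / 2)
    (a : ℝ) :
    (BlowUp.levelSet Ω Γ₀ p a ∩ BlowUp.B2 Ω Γ₀ Γ₁ p).Nonempty := by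
  have hne : Ω.Nonempty := by
    rw [nonempty_iff_ne_empty]
    rintro rfl
    rw [BlowUp.surfaceMeasure, frontier_empty, Measure.restrict_empty] at hΓ₀_pos
    simp at hΓ₀_pos
  have htop : BlowUp.S1 Ω Γ₀ Γ₁ + BlowUp.S2 Ω Γ₀ ≠ ⊤ :=
    BlowUp.S1_add_S2_ne_top hΩ_open hΩ_bdd hΩ_C1 hΓ_union hΓ_closure fun x hx =>
      nonempty_of_measure_ne_zero (hΓ₀_comp x hx).ne'
  have hS : 0 < (BlowUp.S1 Ω Γ₀ Γ₁ + BlowUp.S2 Ω Γ₀).toReal :=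
    ENNReal.toReal_pos ((BlowUp.S2_pos hΩ_open hne).trans_le le_add_self).ne' htop
  set c := (p - 2) / (2 * p * (BlowUp.S1 Ω Γ₀ Γ₁ + BlowUp.S2 Ω Γ₀).toReal) with hc
  have hc0 : 0 < c := div_pos (by linarith) (by positivity)
  -- The summand `|a|` puts the energy of `ψ` above `a`; the summand `|a| / c` makes `c ‖ψ‖₂²`
  -- exceed `a`, and scaling by `t ≥ 1` preserves this.
  obtain ⟨ψ, hψ, hψ1, hψ2⟩ := BlowUp.exists_isTestFunction_large hn hΩ_open hne
    (show 0 < p by linarith) (|a| + |a| / c)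
  have hR : 0 ≤ |a| / c := by positivity
  have hψ0 : hψ.toL2 ≠ 0 := by
    rintro h
    rw [h, norm_zero, zero_pow two_ne_zero] at hψ1
    linarith [abs_nonneg a]
  obtain ⟨t, ht, hta⟩ := hψ.exists_J_const_smul_eq hΩ_open hψ0 hp
    (show a ≤ _ by linarith [le_abs_self a])
  have hmem := (hψ.const_smul t).toL2_mem_H1Gamma hΩ_open Γ₀
  refine ⟨_, ⟨hmem, hta⟩, hmem, ?_⟩
  rw [hta, ← hc]
  have h1 : ‖hψ.toL2‖ ^ 2 ≤ ‖(hψ.const_smul t).toL2‖ ^ 2 := by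
    rw [BlowUp.IsTestFunction.toL2_const_smul t hψ, norm_smul, mul_pow, Real.norm_eq_abs, sq_abs]
    exact le_mul_of_one_le_left (sq_nonneg _) (one_le_pow₀ ht)
  have h2 : 0 ≤ BlowUp.boundaryNormSq Ω Γ₁ (hψ.const_smul t).toL2 :=
    integral_nonneg fun x => sq_nonneg _
  calc a ≤ c * (|a| / c) := by rw [mul_div_cancel₀ _ hc0.ne']; exact le_abs_self a
    _ < c * (‖(hψ.const_smul t).toL2‖ ^ 2 +
        BlowUp.boundaryNormSq Ω Γ₁ (hψ.const_smul t).toL2) := by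
      gcongr
      linarith [abs_nonneg a]
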